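/- Let $\epsilon,h_b\ge 0$, $\kappa>0$, and let $v\in\ell^1(\mathbb Z^2,\mathbb R)$ satisfy $v(-x)=v(x)$ and $v(-x_2,x_1)=v(x_1,x_2)$ for all $x=(x_1,x_2)\in\mathbb Z^2$. Let $\hat v(k)=\sum_{x\in\mathbb Z^2}e^{-ik\cdot x}v(x)$. Let $a_{x,s},a^*_{x,s}$ ($x\in\mathbb Z^2$, $s\in\{\uparrow,\downarrow\}$) and $b_x,b^*_x$ be the annihilation and creation operators of spin-$\frac12$ fermions and of spinless bosons on the lattice $\mathbb Z^2$, acting on the tensor product of the fermionic and the bosonic Fock spaces, put $n_{x,s}=a^*_{x,s}a_{x,s}$ and $c_x=\sum_{z\in\mathbb Z^2,|z|\le1}e^{-\kappa|z|}a_{x+z,\uparrow}a_{x,\downarrow}$, and for $U\ge0$ let $$\mathbf H=\epsilon\Big(-\tfrac12\sum_{s,\,|x-y|=1}a^*_{x,s}a_{y,s}+2\sum_{s,x}a^*_{x,s}a_{x,s}\Big)+U\sum_x n_{x,\uparrow}n_{x,\downarrow}+\epsilon h_b\Big(-\tfrac12\sum_{|x-y|=1}b_x^*b_y+2\sum_x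 b^*_xb_x\Big)+\sum_{x,y}v(x-y)\big(b_x^*c_y+c_y^*b_x\big).$$ Let $H^{(2,1)}$ be the bounded self-adjoint operator that is the restriction of $\mathbf H$ to its invariant subspace $\mathcal H^{(2,1)}_{\uparrow,\downarrow}\simeq\ell^2(\mathbb Z^2\times\mathbb Z^2)\oplus\ell^2(\mathbb Z^2)$ of states with either one $\uparrow$-fermion, one $\downarrow$-fermion and no boson, or no fermion and one boson; let $E_0=E_0(U)=\inf\sigma(H^{(2,1)})$. For $q=(q_1,q_2)$ write $\cos(q)=\cos q_1+\cos q_2$. For $k\in[-\pi,\pi)^2$ and $\lambda<0$ let $$R_{ss}=\frac1{(2\pi)^2}\int_{[-\pi,\pi)^2}\frac{d^2q}{D(q)},\qquad R_{dd}=\frac1{(2\pi)^2}\int_{[-\pi,\pi)^2}\frac{(1+2e^{-\kappa}\cos(q-k))^2}{D(q)}\,d^2q,\qquad R_{sd}=\frac1{(2\pi)^2}\int_{[-\pi,\pi)^2}\frac{1+2e^{-\kappa}\cos(q-k)}{D(q)}\,d^2q,$$ where $D(q)=\epsilon\big(4-\cos(q-k)-\cos(q)\big)-\lambda$, and define, in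 $[0,\infty]$, $$I(k,U)=\limsup_{\lambda\to0^-}|\hat v(k)|^2\Big\{\frac{R_{dd}}{1+UR_{ss}}+U\,\frac{R_{dd}R_{ss}-R_{sd}^2}{1+UR_{ss}}\Big\},\qquad I(k,\infty)=\limsup_{\lambda\to0^-}|\hat v(k)|^2\,\frac{R_{dd}R_{ss}-R_{sd}^2}{R_{ss}}.$$ (i) For every $U\ge0$: $E_0(U)<0$ if and only if $$\sup_{k\in[-\pi,\pi)^2}\big\{I(k,U)-\epsilon h_b(2-\cos(k))\big\}>0 .$$ The latter always holds whenever $\hat v(0)\ne0$. (ii) $\liminf_{U\to\infty}E_0(U)<0$ if and only if $$\sup_{k\in[-\pi,\pi)^2}\big\{I(k,\infty)-\epsilon h_b(2-\cos(k))\big\}>0 .$$ -/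

import Mathlib

open Filter Topology MeasureTheory

noncomputable section

namespace BipolaronElectron

/-! ### Wave functions on the lattice and second quantization -/

/-- The lattice `ℤ²`. -/
abbrev Site : Type := ℤ × ℤ

/-- The spin of an electron. -/
inductive Spin where
  | up
  | down
  deriving DecidableEq

/-- The four lattice vectors `z ∈ ℤ²` with `|z| = 1`. -/
def unitVectors : Finset Site := {(1, 0), (-1, 0), (0, 1), (0, -1)}

/-- Families of wave functions `ψ = (ψ_{m,n})` of `m` electrons (lattice site and spin) and
`n` bosons (lattice site).  The compound Fock space is the space of those families that are
antisymmetric in the electrons, symmetric in the bosons and square summable.  Every operator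
below acts on a family by evaluating the usual formula at each configuration. -/
abbrev WaveFamily : Type :=
  (m n : ℕ) → (Fin m → Site × Spin) → (Fin n → Site) → ℂ

/-- Fermionic annihilation operator `a_{x,s}`, `p = (x,s)`. -/
def annF (p : Site × Spin) (ψ : WaveFamily) : WaveFamily :=
  fun m n q y => (Real.sqrt (m + 1) : ℂ) * ψ (m + 1) n (Fin.cons p q) y

/-- Fermionic creation operator `a*_{x,s}`, `p = (x,s)`. -/
def creF (p : Site × Spin) (ψ : WaveFamily) : WaveFamily
  | 0, _, _, _ => 0
  | m + 1, n, q, y =>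
      (Real.sqrt (m + 1) : ℂ)⁻¹ *
        ∑ j : Fin (m + 1), if q j = p then (-1) ^ (j : ℕ) * ψ m n (j.removeNth q) y else 0

/-- Bosonic annihilation operator `b_x`. -/
def annB (x : Site) (ψ : WaveFamily) : WaveFamily :=
  fun m n q y => (Real.sqrt (n + 1) : ℂ) * ψ m (n + 1) q (Fin.cons x y)

/-- Bosonic creation operator `b*_x`. -/
def creB (x : Site) (ψ : WaveFamily) : WaveFamily
  | _, 0, _, _ => 0
  | m, n + 1, q, y =>
      (Real.sqrt (n + 1) : ℂ)⁻¹ *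
        ∑ j : Fin (n + 1), if y j = x then ψ m n q (j.removeNth y) else 0

/-- `c_x = ∑_{|z| ≤ 1} e^{-κ|z|} a_{x+z,↑} a_{x,↓}`. -/
def annPair (κ : ℝ) (x : Site) (ψ : WaveFamily) : WaveFamily :=
  annF (x, .up) (annF (x, .down) ψ) +
    (Real.exp (-κ) : ℂ) • ∑ z ∈ unitVectors, annF (x + z, .up) (annF (x, .down) ψ)

/-- The adjoint `c_x* = ∑_{|z| ≤ 1} e^{-κ|z|} a*_{x,↓} a*_{x+z,↑}`. -/
def crePair (κ : ℝ) (x : Site) (ψ : WaveFamily) : WaveFamily :=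
  creF (x, .down) (creF (x, .up) ψ) +
    (Real.exp (-κ) : ℂ) • ∑ z ∈ unitVectors, creF (x, .down) (creF (x + z, .up) ψ)

/-- `-½ ∑_{|x-y|=1} a*_{x,s} a_{y,s} + 2 ∑_x a*_{x,s} a_{x,s}`. -/
def kineticF (s : Spin) (ψ : WaveFamily) : WaveFamily := fun m n q y =>
  -(1 / 2) * (∑' x : Site, ∑ z ∈ unitVectors, creF (x, s) (annF (x + z, s) ψ) m n q y)
    + 2 * ∑' x : Site, creF (x, s) (annF (x, s) ψ) m n q y

/-- `-½ ∑_{|x-y|=1} b*_x b_y + 2 ∑_x b*_x b_x`. -/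
def kineticB (ψ : WaveFamily) : WaveFamily := fun m n q y =>
  -(1 / 2) * (∑' x : Site, ∑ z ∈ unitVectors, creB x (annB (x + z) ψ) m n q y)
    + 2 * ∑' x : Site, creB x (annB x ψ) m n q y

/-- The Hubbard interaction `∑_x n_{x,↑} n_{x,↓}`, with `n_{x,s} = a*_{x,s} a_{x,s}`. -/
def hubbard (ψ : WaveFamily) : WaveFamily := fun m n q y =>
  ∑' x : Site, creF (x, .up) (annF (x, .up) (creF (x, .down) (annF (x, .down) ψ))) m n q y

/-- The exchange interaction `W = ∑_{x,y} v(x-y) (b*_x c_y + c_y* b_x)`. -/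
def exchange (κ : ℝ) (v : Site → ℝ) (ψ : WaveFamily) : WaveFamily := fun m n q y =>
  ∑' p : Site × Site, (v (p.1 - p.2) : ℂ) *
    (creB p.1 (annPair κ p.2 ψ) m n q y + crePair κ p.2 (annB p.1 ψ) m n q y)

/-- The full Hamiltonian `H_f + H_b + W`. -/
def hamiltonian (ε hb κ U : ℝ) (v : Site → ℝ) (ψ : WaveFamily) : WaveFamily :=
  ((ε : ℂ) • (kineticF .up ψ + kineticF .down ψ) + (U : ℂ) • hubbard ψ)
    + ((ε * hb : ℝ) : ℂ) • kineticB ψ + exchange κ v ψ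

/-! ### The sector of one electron pair of total spin zero or one boson -/

/-- `ℓ²(ℤ² × ℤ²)`: wave functions `c(x_↑, x_↓)` of one pair. -/
abbrev PairSpace : Type := lp (fun _ : Site × Site => ℂ) 2

/-- `ℓ²(ℤ²)`: wave functions of one boson. -/
abbrev BosonSpace : Type := lp (fun _ : Site => ℂ) 2

/-- The Hilbert space `ℓ²(ℤ² × ℤ²) × ℓ²(ℤ²)`. -/
abbrev SectorSpace : Type := WithLp 2 (PairSpace × BosonSpace)

/-- The antisymmetric two-electron wave function of the pair `c`, normalized in such a way that
`a_{x,↑} a_{y,↓}` sends it to `c (x, y)` (see `annF_annF_embed`). -/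
def pairWave (c : Site × Site → ℂ) : Site × Spin → Site × Spin → ℂ
  | (x, .down), (y, .up) => (Real.sqrt 2 : ℂ)⁻¹ * c (y, x)
  | (x, .up), (y, .down) => -((Real.sqrt 2 : ℂ)⁻¹ * c (x, y))
  | (_, .up), (_, .up) => 0
  | (_, .down), (_, .down) => 0

/-- The canonical identification of `ℓ²(ℤ² × ℤ²) × ℓ²(ℤ²)` with the sector
`(2 electrons of total spin zero, 0 bosons) ⊕ (0 electrons, 1 boson)` of Fock space. -/
def embed (Ψ : SectorSpace) : WaveFamily
  | 2, 0, q, _ => pairWave (fun p => Ψ.fst p) (q 0) (q 1)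
  | 0, 1, _, y => Ψ.snd (y 0)
  | _, _, _, _ => 0

theorem annF_annF_embed (Ψ : SectorSpace) (x y : Site) (q : Fin 0 → Site × Spin)
    (r : Fin 0 → Site) :
    annF (x, .up) (annF (y, .down) (embed Ψ)) 0 0 q r = Ψ.fst (x, y) := by
  have h : (Real.sqrt 2 : ℂ) ≠ 0 := by
    exact_mod_cast (Real.sqrt_pos.2 (by norm_num : (0:ℝ) < 2)).ne'
  simp [annF, embed, pairWave, one_add_one_eq_two, h]

/-! ### Existence of the restriction of the Hamiltonian to the sector -/

/-- Composition with an injective map, as a bounded operator on `ℓ²`. -/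
def pull {α β : Type} (f : α → β) (hf : Function.Injective f) :
    lp (fun _ : β => ℂ) 2 →L[ℂ] lp (fun _ : α => ℂ) 2 :=
  LinearMap.mkContinuous
    { toFun := fun g => ⟨fun a => g (f a), by
        have h := (lp.memℓp g).summable (by norm_num)
        exact memℓp_gen (h.comp_injective hf)⟩
      map_add' := fun g h => by ext a; rfl
      map_smul' := fun c g => by ext a; rfl } 1 (by
    intro g
    have h := lp.hasSum_norm (p := 2) (by norm_num) g
    refine lp.norm_le_of_tsum_le (by norm_num) (by positivity) ?_
    rw [one_mul, ← h.tsum_eq]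
    exact (h.summable.comp_injective hf).tsum_le_tsum_of_inj f hf
      (fun c _ => by positivity) (fun i => le_rfl) h.summable)

theorem pull_apply {α β : Type} (f : α → β) (hf : Function.Injective f)
    (g : lp (fun _ : β => ℂ) 2) (a : α) : pull f hf g a = g (f a) := rfl

theorem norm_pull_le {α β : Type} (f : α → β) (hf : Function.Injective f) : ‖pull f hf‖ ≤ 1 :=
  LinearMap.mkContinuous_norm_le _ zero_le_one _

theorem adjoint_pull_apply {α β : Type} [DecidableEq β] (f : α → β) (hf : Function.Injective f)
    (g : lp (fun _ : α => ℂ) 2) (a : α) :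
    (ContinuousLinearMap.adjoint (pull f hf)) g (f a) = g a := by
  classical
  have h1 := lp.inner_single_left (𝕜 := ℂ) (f a) (1 : ℂ)
    ((ContinuousLinearMap.adjoint (pull f hf)) g)
  have h2 := lp.inner_single_left (𝕜 := ℂ) a (1 : ℂ) g
  rw [ContinuousLinearMap.adjoint_inner_right] at h1
  have h3 : pull f hf (lp.single 2 (f a) (1 : ℂ)) = lp.single 2 a (1 : ℂ) := by
    ext b
    rw [pull_apply, lp.single_apply, lp.single_apply]
    by_cases hb : b = a
    · subst hb; simp
    · have : f b ≠ f a := fun h => hb (hf h)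
      simp [hb, this]
  rw [h3, h2] at h1
  simpa using h1.symm

theorem adjoint_pull_apply_of_notMem {α β : Type} [DecidableEq β] (f : α → β)
    (hf : Function.Injective f) (g : lp (fun _ : α => ℂ) 2) (b : β) (hb : ∀ a, f a ≠ b) :
    (ContinuousLinearMap.adjoint (pull f hf)) g b = 0 := by
  have h1 := lp.inner_single_left (𝕜 := ℂ) b (1 : ℂ)
    ((ContinuousLinearMap.adjoint (pull f hf)) g)
  rw [ContinuousLinearMap.adjoint_inner_right] at h1
  have h3 : pull f hf (lp.single 2 b (1 : ℂ)) = 0 := by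
    ext a
    rw [pull_apply, lp.single_apply]
    simp [hb a]
  rw [h3] at h1
  simpa using h1.symm

theorem embed_one (Ψ : SectorSpace) (n : ℕ) : embed Ψ 1 n = 0 := by
  funext q y; rfl

theorem embed_add_three (Ψ : SectorSpace) (m n : ℕ) : embed Ψ (m + 3) n = 0 := by
  funext q y; rfl

theorem embed_two_succ (Ψ : SectorSpace) (n : ℕ) : embed Ψ 2 (n + 1) = 0 := by
  funext q y; rfl

theorem embed_zero_zero (Ψ : SectorSpace) : embed Ψ 0 0 = 0 := by
  funext q y; rfl

theorem embed_zero_add_two (Ψ : SectorSpace) (n : ℕ) : embed Ψ 0 (n + 2) = 0 := by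
  funext q y; rfl

theorem hasSum_creF (s : Spin) (φ : Site → WaveFamily) (m n : ℕ) (q : Fin (m + 1) → Site × Spin)
    (y : Fin n → Site) :
    HasSum (fun x => creF (x, s) (φ x) (m + 1) n q y)
      ((Real.sqrt (m + 1) : ℂ)⁻¹ * ∑ j : Fin (m + 1),
        if (q j).2 = s then (-1) ^ (j : ℕ) * φ (q j).1 m n (j.removeNth q) y else 0) := by
  simp only [creF]
  refine (hasSum_sum fun j _ => ?_).mul_left _
  have h := hasSum_single (f := fun x => if q j = (x, s) then
    (-1 : ℂ) ^ (j : ℕ) * φ x m n (j.removeNth q) y else 0) (q j).1 (by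
      intro x hx
      rw [if_neg]
      intro h
      exact hx (by rw [h]))
  have e : (if (q j).2 = s then (-1 : ℂ) ^ (j : ℕ) * φ (q j).1 m n (j.removeNth q) y else 0) =
      if q j = ((q j).1, s) then (-1 : ℂ) ^ (j : ℕ) * φ (q j).1 m n (j.removeNth q) y else 0 := by
    by_cases hs : (q j).2 = s
    · rw [if_pos hs, if_pos (by rw [← hs])]
    · rw [if_neg hs, if_neg (fun h => hs (by rw [h]))]
  rw [e]
  exact h

theorem hasSum_creB (φ : Site → WaveFamily) (m n : ℕ) (q : Fin m → Site × Spin)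
    (y : Fin (n + 1) → Site) :
    HasSum (fun x => creB x (φ x) m (n + 1) q y)
      ((Real.sqrt (n + 1) : ℂ)⁻¹ * ∑ j : Fin (n + 1), φ (y j) m n q (j.removeNth y)) := by
  simp only [creB]
  refine (hasSum_sum fun j _ => ?_).mul_left _
  have h := hasSum_single (f := fun x => if y j = x then
    φ x m n q (j.removeNth y) else 0) (y j) (by
      intro x hx
      rw [if_neg (Ne.symm hx)])
  simpa using h

/-- The action of the Hamiltonian on the pair component. -/
def pairAction (ε κ U : ℝ) (v : Site → ℝ) (c : Site × Site → ℂ) (b : Site → ℂ)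
    (p : Site × Site) : ℂ :=
  ε * (-(1 / 2) * (∑ z ∈ unitVectors, c (p.1 + z, p.2)) -
      1 / 2 * (∑ z ∈ unitVectors, c (p.1, p.2 + z)) + 4 * c p)
    + U * (if p.1 = p.2 then c p else 0)
    + (∑' w : Site, v (w - p.2) * b w) *
      ((if p.1 = p.2 then 1 else 0) +
        Real.exp (-κ) * ∑ z ∈ unitVectors, if p.1 = p.2 + z then 1 else 0)

/-- The action of the Hamiltonian on the boson component. -/
def bosonAction (ε hb κ : ℝ) (v : Site → ℝ) (c : Site × Site → ℂ) (b : Site → ℂ)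
    (x : Site) : ℂ :=
  ε * hb * (-(1 / 2) * (∑ z ∈ unitVectors, b (x + z)) + 2 * b x)
    + ∑' w : Site, v (x - w) * (c (w, w) + Real.exp (-κ) * ∑ z ∈ unitVectors, c (w + z, w))

theorem sqrtTwo_ne : (Real.sqrt 2 : ℂ) ≠ 0 := by
  exact_mod_cast (Real.sqrt_pos.2 (by norm_num : (0:ℝ) < 2)).ne'

theorem sqrtTwo_mul : (Real.sqrt 2 : ℂ) * Real.sqrt 2 = 2 := by
  exact_mod_cast Real.mul_self_sqrt (by norm_num : (0:ℝ) ≤ 2)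

theorem kineticF_zero (s : Spin) (ψ : WaveFamily) (n : ℕ) (q : Fin 0 → Site × Spin)
    (y : Fin n → Site) : kineticF s ψ 0 n q y = 0 := by
  simp [kineticF, creF]

theorem kineticF_succ (s : Spin) (ψ : WaveFamily) (m n : ℕ) (q : Fin (m + 1) → Site × Spin)
    (y : Fin n → Site) : kineticF s ψ (m + 1) n q y =
      ∑ j : Fin (m + 1), if (q j).2 = s then (-1) ^ (j : ℕ) *
        (-(1 / 2) * (∑ z ∈ unitVectors,
            ψ (m + 1) n (Fin.cons ((q j).1 + z, s) (j.removeNth q)) y)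
          + 2 * ψ (m + 1) n (Fin.cons ((q j).1, s) (j.removeNth q)) y) else 0 := by
  have hne : (Real.sqrt (m + 1) : ℂ) ≠ 0 := by
    exact_mod_cast (Real.sqrt_pos.2 (by positivity : (0:ℝ) < m + 1)).ne'
  have h1 := hasSum_sum (s := unitVectors) fun z _ =>
    hasSum_creF s (fun x => annF (x + z, s) ψ) m n q y
  have h2 := hasSum_creF s (fun x => annF (x, s) ψ) m n q y
  rw [kineticF, h1.tsum_eq, h2.tsum_eq]
  simp only [annF]
  rw [← Finset.mul_sum, Finset.sum_comm]
  simp only [Finset.mul_sum]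
  rw [← Finset.sum_add_distrib]
  refine Finset.sum_congr rfl fun j _ => ?_
  by_cases hs : (q j).2 = s
  · simp only [hs, if_true, mul_add, Finset.mul_sum]
    congr 1
    · refine Finset.sum_congr rfl fun z _ => ?_
      field_simp
    · field_simp
  · simp [hs]

theorem kineticB_zero (ψ : WaveFamily) (m : ℕ) (q : Fin m → Site × Spin)
    (y : Fin 0 → Site) : kineticB ψ m 0 q y = 0 := by
  simp [kineticB, creB]

theorem kineticB_succ (ψ : WaveFamily) (m n : ℕ) (q : Fin m → Site × Spin)
    (y : Fin (n + 1) → Site) : kineticB ψ m (n + 1) q y =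
      ∑ j : Fin (n + 1),
        (-(1 / 2) * (∑ z ∈ unitVectors, ψ m (n + 1) q (Fin.cons (y j + z) (j.removeNth y)))
          + 2 * ψ m (n + 1) q (Fin.cons (y j) (j.removeNth y))) := by
  have hne : (Real.sqrt (n + 1) : ℂ) ≠ 0 := by
    exact_mod_cast (Real.sqrt_pos.2 (by positivity : (0:ℝ) < n + 1)).ne'
  have h1 := hasSum_sum (s := unitVectors) fun z _ =>
    hasSum_creB (fun x => annB (x + z) ψ) m n q y
  have h2 := hasSum_creB (fun x => annB x ψ) m n q y
  rw [kineticB, h1.tsum_eq, h2.tsum_eq]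
  simp only [annB]
  rw [← Finset.mul_sum, Finset.sum_comm]
  simp only [Finset.mul_sum]
  rw [← Finset.sum_add_distrib]
  refine Finset.sum_congr rfl fun j _ => ?_
  congr 1
  · refine Finset.sum_congr rfl fun z _ => ?_
    field_simp
  · field_simp

theorem hubbard_zero (ψ : WaveFamily) (n : ℕ) (q : Fin 0 → Site × Spin)
    (y : Fin n → Site) : hubbard ψ 0 n q y = 0 := by
  simp [hubbard, creF]

theorem hubbard_succ (ψ : WaveFamily) (m n : ℕ) (q : Fin (m + 1) → Site × Spin)
    (y : Fin n → Site) : hubbard ψ (m + 1) n q y =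
      ∑ j : Fin (m + 1), if (q j).2 = .up then (-1) ^ (j : ℕ) *
        creF ((q j).1, .down) (annF ((q j).1, .down) ψ) (m + 1) n
          (Fin.cons ((q j).1, .up) (j.removeNth q)) y else 0 := by
  have hne : (Real.sqrt (m + 1) : ℂ) ≠ 0 := by
    exact_mod_cast (Real.sqrt_pos.2 (by positivity : (0:ℝ) < m + 1)).ne'
  have h := hasSum_creF .up (fun x => annF (x, .up) (creF (x, .down) (annF (x, .down) ψ))) m n q y
  rw [hubbard, h.tsum_eq, Finset.mul_sum]
  refine Finset.sum_congr rfl fun j _ => ?_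
  by_cases hs : (q j).2 = .up
  · simp only [hs, if_true]
    rw [annF]
    field_simp
  · simp [hs]

theorem kineticF_embed_two (s : Spin) (Ψ : SectorSpace) (q : Fin 2 → Site × Spin)
    (y : Fin 0 → Site) : kineticF s (embed Ψ) 2 0 q y =
      (if (q 0).2 = s then -(1 / 2) * (∑ z ∈ unitVectors,
          pairWave (fun p => Ψ.fst p) ((q 0).1 + z, s) (q 1))
          + 2 * pairWave (fun p => Ψ.fst p) ((q 0).1, s) (q 1) else 0)
      - (if (q 1).2 = s then -(1 / 2) * (∑ z ∈ unitVectors,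
          pairWave (fun p => Ψ.fst p) ((q 1).1 + z, s) (q 0))
          + 2 * pairWave (fun p => Ψ.fst p) ((q 1).1, s) (q 0) else 0) := by
  rw [kineticF_succ, Fin.sum_univ_two]
  by_cases h0 : (q 0).2 = s <;> by_cases h1 : (q 1).2 = s <;>
    simp [h0, h1, embed, Fin.removeNth, Fin.succAbove, Fin.tail]
  ring

theorem hubbard_embed_two (Ψ : SectorSpace) (q : Fin 2 → Site × Spin)
    (y : Fin 0 → Site) : hubbard (embed Ψ) 2 0 q y =
      if (q 0).1 = (q 1).1 then pairWave (fun p => Ψ.fst p) (q 0) (q 1) else 0 := by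
  rw [hubbard_succ, Fin.sum_univ_two]
  rcases h0 : q 0 with ⟨x0, s0⟩
  rcases h1 : q 1 with ⟨x1, s1⟩
  cases s0 <;> cases s1 <;>
    simp [h0, h1, creF, annF, embed, pairWave, Fin.removeNth, Fin.succAbove, Fin.tail, Fin.sum_univ_two,
      one_add_one_eq_two, eq_comm] <;>
    by_cases h : x0 = x1 <;> simp [h]

theorem annPair_embed (κ : ℝ) (Ψ : SectorSpace) (x : Site) (q : Fin 0 → Site × Spin)
    (r : Fin 0 → Site) : annPair κ x (embed Ψ) 0 0 q r =
      Ψ.fst (x, x) + Real.exp (-κ) * ∑ z ∈ unitVectors, Ψ.fst (x + z, x) := by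
  simp only [annPair, Pi.add_apply, Pi.smul_apply, Finset.sum_apply, annF_annF_embed, smul_eq_mul]

theorem exchange_embed_boson (κ : ℝ) (v : Site → ℝ) (Ψ : SectorSpace) (q : Fin 0 → Site × Spin)
    (y : Fin 1 → Site) : exchange κ v (embed Ψ) 0 1 q y =
      ∑' w : Site, v (y 0 - w) *
        (Ψ.fst (w, w) + Real.exp (-κ) * ∑ z ∈ unitVectors, Ψ.fst (w + z, w)) := by
  have h : ∀ p : Site × Site, (v (p.1 - p.2) : ℂ) *
      (creB p.1 (annPair κ p.2 (embed Ψ)) 0 1 q y + crePair κ p.2 (annB p.1 (embed Ψ)) 0 1 q y) =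
      if y 0 = p.1 then (v (p.1 - p.2) : ℂ) * (Ψ.fst (p.2, p.2) +
        Real.exp (-κ) * ∑ z ∈ unitVectors, Ψ.fst (p.2 + z, p.2)) else 0 := by
    intro p
    by_cases hp : y 0 = p.1 <;> simp [creB, crePair, creF, annPair_embed, hp]
  rw [exchange, tsum_congr h,
    ← (show Function.Injective (fun w : Site => (y 0, w)) from
      fun a b hab => (Prod.ext_iff.1 hab).2).tsum_eq]
  · simp
  · rintro ⟨a, b⟩ hab
    by_cases hp : y 0 = a
    · exact ⟨b, by simp [hp]⟩
    · simp [hp] at hab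

theorem creF_creF_two (x u : Site) (φ : WaveFamily) (q : Fin 2 → Site × Spin)
    (y r : Fin 0 → Site) (q' : Fin 0 → Site × Spin) :
    creF (x, .down) (creF (u, .up) φ) 2 0 q y = (Real.sqrt 2 : ℂ)⁻¹ *
      ((if q 0 = (x, .down) ∧ q 1 = (u, .up) then 1 else 0) -
        (if q 1 = (x, .down) ∧ q 0 = (u, .up) then 1 else 0)) * φ 0 0 q' r := by
  have e1 : y = r := Subsingleton.elim _ _
  subst e1
  by_cases h0 : q 0 = (x, .down) <;> by_cases h1 : q 1 = (x, .down) <;>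
  by_cases h2 : q 0 = (u, .up) <;> by_cases h3 : q 1 = (u, .up) <;>
    simp_all [creF, Fin.sum_univ_two, one_add_one_eq_two, Fin.removeNth, Fin.succAbove] <;>
    exact congrArg (fun t => φ 0 0 t y) (Subsingleton.elim _ _)

theorem exchange_embed_pair (κ : ℝ) (v : Site → ℝ) (Ψ : SectorSpace) (q : Fin 2 → Site × Spin)
    (y : Fin 0 → Site) : exchange κ v (embed Ψ) 2 0 q y =
      pairWave (fun p => (∑' w : Site, v (w - p.2) * Ψ.snd w) *
        ((if p.1 = p.2 then 1 else 0) +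
          Real.exp (-κ) * ∑ z ∈ unitVectors, if p.1 = p.2 + z then 1 else 0)) (q 0) (q 1) := by
  have hb : ∀ x : Site, annB x (embed Ψ) 0 0 Fin.elim0 Fin.elim0 = Ψ.snd x := by
    intro x; simp [annB, embed]
  have h : ∀ p : Site × Site, (v (p.1 - p.2) : ℂ) *
      (creB p.1 (annPair κ p.2 (embed Ψ)) 2 0 q y + crePair κ p.2 (annB p.1 (embed Ψ)) 2 0 q y) =
      (Real.sqrt 2 : ℂ)⁻¹ * ((v (p.1 - p.2) * Ψ.snd p.1) *
        (((if q 0 = (p.2, .down) ∧ q 1 = (p.2, .up) then 1 else 0) -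
          (if q 1 = (p.2, .down) ∧ q 0 = (p.2, .up) then 1 else 0)) +
        Real.exp (-κ) * ∑ z ∈ unitVectors,
          ((if q 0 = (p.2, .down) ∧ q 1 = (p.2 + z, .up) then 1 else 0) -
          (if q 1 = (p.2, .down) ∧ q 0 = (p.2 + z, .up) then 1 else 0)))) := by
    intro p
    simp only [creB, crePair, Pi.add_apply, Pi.smul_apply, Finset.sum_apply, smul_eq_mul,
      creF_creF_two _ _ _ q y Fin.elim0 Fin.elim0, hb]
    rw [← Finset.sum_mul, ← Finset.mul_sum]
    ring
  rw [exchange, tsum_congr h, tsum_mul_left]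
  have key : ∀ (a : Site) (g : Site → ℂ),
      ∑' p : Site × Site, (v (p.1 - p.2) * Ψ.snd p.1 : ℂ) * (if a = p.2 then g p.2 else 0) =
        (∑' w : Site, v (w - a) * Ψ.snd w) * g a := by
    intro a g
    rw [← (show Function.Injective (fun w : Site => (w, a)) from
      fun c d hcd => (Prod.ext_iff.1 hcd).1).tsum_eq]
    · simp [tsum_mul_right]
    · rintro ⟨c, d⟩ hcd
      by_cases hp : a = d
      · exact ⟨c, by simp [hp]⟩
      · simp [hp] at hcd
  rcases h0 : q 0 with ⟨x0, s0⟩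
  rcases h1 : q 1 with ⟨x1, s1⟩
  cases s0 <;> cases s1
  · simp [pairWave]
  · simp only [pairWave]
    rw [← key x1 (fun a => (if x0 = a then 1 else 0) +
          Real.exp (-κ) * ∑ z ∈ unitVectors, if x0 = a + z then 1 else 0), ← mul_neg, ← tsum_neg]
    congr 1
    refine tsum_congr fun p => ?_
    by_cases hp : x1 = p.2
    · subst hp; simp; ring
    · simp [hp]
  · simp only [pairWave]
    rw [← key x0 (fun a => (if x1 = a then 1 else 0) +
          Real.exp (-κ) * ∑ z ∈ unitVectors, if x1 = a + z then 1 else 0)]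
    congr 1
    refine tsum_congr fun p => ?_
    by_cases hp : x0 = p.2
    · subst hp; simp
    · simp [hp]
  · simp [pairWave]

theorem hamiltonian_embed (ε hb κ U : ℝ) (v : Site → ℝ) (Ψ Φ : SectorSpace)
    (hc : ∀ p, Φ.fst p = pairAction ε κ U v (fun p => Ψ.fst p) (fun x => Ψ.snd x) p)
    (hbos : ∀ x, Φ.snd x = bosonAction ε hb κ v (fun p => Ψ.fst p) (fun x => Ψ.snd x) x) :
    hamiltonian ε hb κ U v (embed Ψ) = embed Φ := by
  have z2 : ∀ (m n : ℕ) (p p' : Site × Spin), embed Ψ (m + 2) n = 0 →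
      annF p (annF p' (embed Ψ)) m n = 0 := by
    intro m n p p' h
    funext q y
    simp [annF, h]
  have zP : ∀ (m n : ℕ) (x : Site), embed Ψ (m + 2) n = 0 → annPair κ x (embed Ψ) m n = 0 := by
    intro m n x h
    funext q y
    simp [annPair, z2 m n _ _ h]
  have zB : ∀ (m n : ℕ) (x : Site), embed Ψ m (n + 1) = 0 → annB x (embed Ψ) m n = 0 := by
    intro m n x h
    funext q y
    simp [annB, h]
  have zC : ∀ (m n : ℕ) (x : Site) (φ : WaveFamily), φ m n = 0 → crePair κ x φ (m + 2) n = 0 := by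
    intro m n x φ h
    funext q y
    simp [crePair, creF, h]
  have zC3 : ∀ (m n : ℕ) (x : Site) (φ : WaveFamily), φ (m + 1) n = 0 →
      crePair κ x φ (m + 3) n = 0 := fun m n x φ h => zC (m + 1) n x φ h
  have zH : ∀ (m n : ℕ), embed Ψ (m + 1) n = 0 → hubbard (embed Ψ) (m + 1) n = 0 := by
    intro m n h
    funext q y
    simp [hubbard_succ, creF, annF, h]
  funext m n q y
  match m, n with
  | 0, 0 =>
    simp [hamiltonian, kineticF_zero, hubbard_zero, kineticB_zero, exchange, creB, crePair, creF,
      embed_zero_zero]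
  | 0, 1 =>
    simp [hamiltonian, kineticF_zero, hubbard_zero, kineticB_succ, exchange_embed_boson, embed,
      hbos, bosonAction]
  | 0, n + 2 =>
    simp [hamiltonian, kineticF_zero, hubbard_zero, kineticB_succ, exchange, creB, crePair, creF,
      embed_zero_add_two, zP 0 (n + 1) _ (embed_two_succ Ψ n)]
  | 1, 0 =>
    simp [hamiltonian, kineticF_succ, kineticB_zero, exchange, creB, crePair, creF,
      embed_one, zH 0 _ (embed_one Ψ _)]
  | 1, n + 1 =>
    simp [hamiltonian, kineticF_succ, kineticB_succ, exchange, creB, crePair, creF,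
      embed_one, zH 0 _ (embed_one Ψ _), zP 1 n _ (embed_add_three Ψ 0 n)]
  | 2, 0 =>
    simp only [hamiltonian, Pi.add_apply, Pi.smul_apply, kineticF_embed_two, hubbard_embed_two,
      kineticB_zero, exchange_embed_pair, smul_eq_mul, mul_zero, add_zero]
    rcases h0 : q 0 with ⟨x0, s0⟩
    rcases h1 : q 1 with ⟨x1, s1⟩
    cases s0 <;> cases s1
    · simp [embed, pairWave, h0, h1]
    · simp [embed, pairWave, h0, h1, hc, pairAction, ← Finset.mul_sum]
      by_cases h : x0 = x1
      · simp [h]; ring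
      · simp [h]; ring
    · simp [embed, pairWave, h0, h1, hc, pairAction, ← Finset.mul_sum]
      by_cases h : x1 = x0
      · simp [h]; ring
      · simp [h, Ne.symm h]; ring
    · simp [embed, pairWave, h0, h1]
  | 2, n + 1 =>
    simp [hamiltonian, kineticF_succ, kineticB_succ, exchange, creB,
      embed_two_succ, zH 1 _ (embed_two_succ Ψ n), zP 2 n _ (embed_add_three Ψ 1 n),
      zC 0 (n + 1) _ _ (zB 0 (n + 1) _ (embed_zero_add_two Ψ n))]
  | m + 3, 0 =>
    simp [hamiltonian, kineticF_succ, kineticB_zero, exchange, creB,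
      embed_add_three, zH (m + 2) 0 (embed_add_three Ψ m 0),
      zC3 m 0 _ _ (zB (m + 1) 0 _ (by funext q y; rcases m with _ | _ | m <;> rfl))]
  | m + 3, n + 1 =>
    simp [hamiltonian, kineticF_succ, kineticB_succ, exchange, creB,
      embed_add_three, zH (m + 2) (n + 1) (embed_add_three Ψ m (n + 1)),
      zP (m + 3) n _ (embed_add_three Ψ (m + 2) n),
      zC3 m (n + 1) _ _ (zB (m + 1) (n + 1) _
        (by funext q y; rcases m with _ | _ | m <;> rfl))]

/-- Convolution `b ↦ ∑_w v(w - ·) b(w)` with a summable function. -/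
def conv (v : Site → ℝ) : BosonSpace →L[ℂ] BosonSpace :=
  ∑' w : Site, (v w : ℂ) • pull (fun x : Site => x + w) (add_left_injective w)

theorem conv_apply (v : Site → ℝ) (hv : Summable v) (b : BosonSpace) (x : Site) :
    conv v b x = ∑' w : Site, v (w - x) * b w := by
  have hs : Summable fun w : Site =>
      (v w : ℂ) • pull (fun x : Site => x + w) (add_left_injective w) := by
    refine Summable.of_norm_bounded (g := fun w => ‖v w‖) hv.norm fun w => ?_
    rw [norm_smul, Complex.norm_real]
    exact mul_le_of_le_one_right (norm_nonneg _) (norm_pull_le _ _)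
  let L : (BosonSpace →L[ℂ] BosonSpace) →L[ℂ] ℂ :=
    (lp.evalCLM ℂ (fun _ : Site => ℂ) 2 x).comp (ContinuousLinearMap.apply ℂ BosonSpace b)
  have h : L (conv v) = ∑' w : Site, L ((v w : ℂ) •
      pull (fun x : Site => x + w) (add_left_injective w)) := L.map_tsum hs
  have h' : conv v b x = ∑' w : Site, (v w : ℂ) * b (x + w) := h
  rw [h', ← (Equiv.subRight x).tsum_eq]
  simp

theorem op_add {α β : Type} (A B : lp (fun _ : β => ℂ) 2 →L[ℂ] lp (fun _ : α => ℂ) 2)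
    (f : lp (fun _ : β => ℂ) 2) (x : α) : (A + B) f x = A f x + B f x := rfl

theorem op_sub {α β : Type} (A B : lp (fun _ : β => ℂ) 2 →L[ℂ] lp (fun _ : α => ℂ) 2)
    (f : lp (fun _ : β => ℂ) 2) (x : α) : (A - B) f x = A f x - B f x := rfl

theorem op_smul {α β : Type} (c : ℂ) (A : lp (fun _ : β => ℂ) 2 →L[ℂ] lp (fun _ : α => ℂ) 2)
    (f : lp (fun _ : β => ℂ) 2) (x : α) : (c • A) f x = c * A f x := rfl

theorem op_sum {α β ι : Type} (s : Finset ι)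
    (A : ι → lp (fun _ : β => ℂ) 2 →L[ℂ] lp (fun _ : α => ℂ) 2)
    (f : lp (fun _ : β => ℂ) 2) (x : α) : (∑ i ∈ s, A i) f x = ∑ i ∈ s, A i f x :=
  map_sum ((lp.evalCLM ℂ (fun _ : α => ℂ) 2 x).comp
    (ContinuousLinearMap.apply ℂ (lp (fun _ : α => ℂ) 2) f)) A s

/-- The pairs of sites at relative distance `z`. -/
def pairAt (z : Site) : PairSpace →L[ℂ] BosonSpace :=
  pull (fun x : Site => (x + z, x)) (fun _ _ h => (Prod.ext_iff.1 h).2)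

theorem adjoint_pairAt_apply (z : Site) (b : BosonSpace) (p : Site × Site) :
    ContinuousLinearMap.adjoint (pairAt z) b p = if p.1 = p.2 + z then b p.2 else 0 := by
  obtain ⟨x, y⟩ := p
  by_cases h : x = y + z
  · subst h
    rw [if_pos rfl]
    exact adjoint_pull_apply (fun x : Site => (x + z, x))
      (fun _ _ h => (Prod.ext_iff.1 h).2) b y
  · rw [if_neg h]
    refine adjoint_pull_apply_of_notMem (fun x : Site => (x + z, x))
      (fun _ _ h => (Prod.ext_iff.1 h).2) b (x, y) fun a ha => h ?_
    have h1 : a + z = x := (Prod.ext_iff.1 ha).1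
    have h2 : a = y := (Prod.ext_iff.1 ha).2
    rw [← h1, h2]

theorem exists_coordinates (ε hb κ U : ℝ) (v : Site → ℝ) (hv : Summable v) :
    ∃ T : SectorSpace →L[ℂ] SectorSpace, ∀ Ψ,
      (∀ p, (T Ψ).fst p = pairAction ε κ U v (fun p => Ψ.fst p) (fun x => Ψ.snd x) p) ∧
      (∀ x, (T Ψ).snd x = bosonAction ε hb κ v (fun p => Ψ.fst p) (fun x => Ψ.snd x) x) := by
  let D : PairSpace →L[ℂ] BosonSpace :=
    pairAt 0 + (Real.exp (-κ) : ℂ) • ∑ z ∈ unitVectors, pairAt z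
  let D' : BosonSpace →L[ℂ] PairSpace :=
    ContinuousLinearMap.adjoint (pairAt 0) +
      (Real.exp (-κ) : ℂ) • ∑ z ∈ unitVectors, ContinuousLinearMap.adjoint (pairAt z)
  let K : PairSpace →L[ℂ] PairSpace :=
    (ε : ℂ) • ((-(1 / 2) : ℂ) • (∑ z ∈ unitVectors,
        pull (fun p : Site × Site => (p.1 + z, p.2))
          (fun a b h => by simpa [Prod.ext_iff] using h))
      - (1 / 2 : ℂ) • (∑ z ∈ unitVectors,
        pull (fun p : Site × Site => (p.1, p.2 + z))
          (fun a b h => by simpa [Prod.ext_iff] using h))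
      + (4 : ℂ) • ContinuousLinearMap.id ℂ PairSpace)
    + (U : ℂ) • (ContinuousLinearMap.adjoint (pairAt 0)).comp (pairAt 0)
  let B : BosonSpace →L[ℂ] BosonSpace :=
    (ε * hb : ℂ) • ((-(1 / 2) : ℂ) • (∑ z ∈ unitVectors,
        pull (fun x : Site => x + z) (add_left_injective z))
      + (2 : ℂ) • ContinuousLinearMap.id ℂ BosonSpace)
  let e := WithLp.prodContinuousLinearEquiv 2 ℂ PairSpace BosonSpace
  refine ⟨(e.symm : PairSpace × BosonSpace →L[ℂ] SectorSpace).comp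
    (((K.comp (WithLp.fstL 2 ℂ PairSpace BosonSpace) +
        (D'.comp (conv v)).comp (WithLp.sndL 2 ℂ PairSpace BosonSpace))).prod
      (B.comp (WithLp.sndL 2 ℂ PairSpace BosonSpace) +
        ((conv fun w => v (-w)).comp D).comp (WithLp.fstL 2 ℂ PairSpace BosonSpace))), fun Ψ => ?_⟩
  refine ⟨fun p => ?_, fun x => ?_⟩
  · change K Ψ.fst p + D' (conv v Ψ.snd) p = _
    have h1 : K Ψ.fst p = ε * (-(1 / 2) * (∑ z ∈ unitVectors, Ψ.fst (p.1 + z, p.2)) -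
        1 / 2 * (∑ z ∈ unitVectors, Ψ.fst (p.1, p.2 + z)) + 4 * Ψ.fst p)
        + U * ContinuousLinearMap.adjoint (pairAt 0) (pairAt 0 Ψ.fst) p := by
      simp only [K, op_add, op_sub, op_smul, op_sum]
      rfl
    have h2 : ∀ b, D' b p = ContinuousLinearMap.adjoint (pairAt 0) b p +
        Real.exp (-κ) * ∑ z ∈ unitVectors, ContinuousLinearMap.adjoint (pairAt z) b p := by
      intro b
      simp only [D', op_add, op_smul, op_sum]
    rw [h1, h2]
    simp only [adjoint_pairAt_apply, conv_apply v hv, pairAction]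
    have h3 : pairAt 0 Ψ.fst p.2 = Ψ.fst (p.2, p.2) := by
      simp [pairAt, pull_apply]
    have h4 : (∑ z ∈ unitVectors,
        if p.1 = p.2 + z then ∑' w : Site, (v (w - p.2) : ℂ) * Ψ.snd w else 0) =
        (∑' w : Site, (v (w - p.2) : ℂ) * Ψ.snd w) *
          ∑ z ∈ unitVectors, if p.1 = p.2 + z then 1 else 0 := by
      rw [Finset.mul_sum]
      exact Finset.sum_congr rfl fun z _ => by split_ifs <;> simp
    rw [h3, h4, add_zero]
    obtain ⟨a, b⟩ := p
    by_cases h : a = b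
    · subst h
      simp only [if_true]
      ring
    · simp only [h, if_false]
      ring
  · change B Ψ.snd x + conv (fun w => v (-w)) (D Ψ.fst) x = _
    have h1 : B Ψ.snd x = ε * hb * (-(1 / 2) * (∑ z ∈ unitVectors, Ψ.snd (x + z)) +
        2 * Ψ.snd x) := by
      simp only [B, op_add, op_smul, op_sum]
      rfl
    have h2 : ∀ w, D Ψ.fst w = Ψ.fst (w, w) +
        Real.exp (-κ) * ∑ z ∈ unitVectors, Ψ.fst (w + z, w) := by
      intro w
      simp only [D, pairAt, op_add, op_smul, op_sum, add_zero]
      rfl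
    have hv' : Summable fun w => v (-w) := (Equiv.neg Site).summable_iff.2 hv
    have h3 := conv_apply (fun w => v (-w)) hv' (D Ψ.fst) x
    rw [bosonAction, ← h1]
    refine congrArg (B Ψ.snd x + ·) (h3.trans (tsum_congr fun w => ?_))
    rw [h2, neg_sub]

/-- There is a bounded operator which acts on the sector as the Hamiltonian does. -/
theorem exists_restriction (ε hb κ U : ℝ) (v : Site → ℝ) (hv : Summable v) :
    ∃ T : SectorSpace →L[ℂ] SectorSpace,
      ∀ Ψ, hamiltonian ε hb κ U v (embed Ψ) = embed (T Ψ) := by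
  obtain ⟨T, hT⟩ := exists_coordinates ε hb κ U v hv
  exact ⟨T, fun Ψ => hamiltonian_embed ε hb κ U v Ψ (T Ψ) (hT Ψ).1 (hT Ψ).2⟩

theorem embed_injective : Function.Injective embed := by
  intro Ψ Φ h
  have h1 : Ψ.fst = Φ.fst := by
    ext ⟨x, y⟩
    rw [← annF_annF_embed Ψ x y Fin.elim0 Fin.elim0, h, annF_annF_embed]
  have h2 : Ψ.snd = Φ.snd := by
    ext x
    exact congrFun (congrFun (congrFun (congrFun h 0) 1) Fin.elim0) (fun _ => x)
  have h3 : WithLp.ofLp Ψ = WithLp.ofLp Φ := Prod.ext h1 h2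
  exact WithLp.ofLp_injective 2 h3

/-! ### The Hamiltonian of the sector, its ground state energy, and the explicit integrals -/

/-- `ℓ¹(ℤ², ℝ)`. -/
abbrev Coupling : Type := lp (fun _ : Site => ℝ) 1

theorem summable_coupling (v : Coupling) : Summable fun x => v x :=
  (lp.memℓp v).summable_of_one

/-- The Hamiltonian `H^(2,1)`: the bounded operator that is the restriction of the full
Hamiltonian to the sector.  It is unique because `embed` is injective. -/
def sectorHamiltonian (ε hb κ : ℝ) (v : Coupling) (U : ℝ) : SectorSpace →L[ℂ] SectorSpace :=
  (exists_restriction ε hb κ U (fun x => v x) (summable_coupling v)).choose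

theorem hamiltonian_embed_eq (ε hb κ : ℝ) (v : Coupling) (U : ℝ) (Ψ : SectorSpace) :
    hamiltonian ε hb κ U (fun x => v x) (embed Ψ) =
      embed (sectorHamiltonian ε hb κ v U Ψ) :=
  (exists_restriction ε hb κ U (fun x => v x) (summable_coupling v)).choose_spec Ψ

/-- The bottom `E₀` of the spectrum of `H^(2,1)`. -/
def groundEnergy (ε hb κ : ℝ) (v : Coupling) (U : ℝ) : ℝ :=
  sInf {t : ℝ | (t : ℂ) ∈ spectrum ℂ (sectorHamiltonian ε hb κ v U)}

/-- The torus `[-π, π)²`. -/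
def torus : Set (ℝ × ℝ) :=
  Set.Ico (-Real.pi) Real.pi ×ˢ Set.Ico (-Real.pi) Real.pi

/-- `cos k = cos k₁ + cos k₂`. -/
def cos₂ (k : ℝ × ℝ) : ℝ := Real.cos k.1 + Real.cos k.2

/-- The Fourier transform `∑_x e^{-ik·x} v(x)`. -/
def fourier (v : Coupling) (k : ℝ × ℝ) : ℂ :=
  ∑' x : Site, Complex.exp (-Complex.I * ((k.1 * x.1 + k.2 * x.2 : ℝ) : ℂ)) * (v x : ℂ)

/-- `R_ss`. -/
def Rss (ε : ℝ) (k : ℝ × ℝ) (l : ℝ) : ℝ :=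
  1 / (2 * Real.pi) ^ 2 * ∫ q in torus, 1 / (ε * (4 - cos₂ (q - k) - cos₂ q) - l)

/-- `R_dd`. -/
def Rdd (ε κ : ℝ) (k : ℝ × ℝ) (l : ℝ) : ℝ :=
  1 / (2 * Real.pi) ^ 2 * ∫ q in torus,
    (1 + 2 * Real.exp (-κ) * cos₂ (q - k)) ^ 2 / (ε * (4 - cos₂ (q - k) - cos₂ q) - l)

/-- `R_sd`. -/
def Rsd (ε κ : ℝ) (k : ℝ × ℝ) (l : ℝ) : ℝ :=
  1 / (2 * Real.pi) ^ 2 * ∫ q in torus,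
    (1 + 2 * Real.exp (-κ) * cos₂ (q - k)) / (ε * (4 - cos₂ (q - k) - cos₂ q) - l)

/-- `I(k, U)`, an extended real number. -/
def criticalValue (ε κ : ℝ) (v : Coupling) (U : ℝ) (k : ℝ × ℝ) : EReal :=
  limsup (fun l : ℝ => ((‖fourier v k‖ ^ 2 *
    (Rdd ε κ k l / (1 + U * Rss ε k l) +
      U * ((Rdd ε κ k l * Rss ε k l - Rsd ε κ k l ^ 2) / (1 + U * Rss ε k l))) : ℝ) : EReal))
    (𝓝[<] 0)

/-- `I(k, ∞)`, an extended real number. -/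
def criticalValueInfinite (ε κ : ℝ) (v : Coupling) (k : ℝ × ℝ) : EReal :=
  limsup (fun l : ℝ => ((‖fourier v k‖ ^ 2 *
    ((Rdd ε κ k l * Rss ε k l - Rsd ε κ k l ^ 2) / Rss ε k l) : ℝ) : EReal)) (𝓝[<] 0)

end BipolaronElectron

end

noncomputable section

namespace BipolaronElectron

/-! ### Averages over the torus -/

/-! The Hamiltonian commutes with translations, so in momentum space it acts separately for each
total momentum `k`. A fibre consists of a pair wave function `φ(q)` and a boson amplitude `β`. With
`d` the pair dispersion measured from an energy `l`, `g` the form factor and `m(k)` the boson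
dispersion, its form is `⟨φ, (d + U|1⟩⟨1|)φ⟩ + 2 Re(conj(v̂(k)β) ∫ gφ) + |β|²(m(k) - l)`. For `l <
0` one has `d ≥ -l > 0`, and completing the square in `φ` leaves a nonnegative term plus `|β|²(m(k)
- l - v̂(k)² S)`, where `S = ⟨g, (d + U|1⟩⟨1|)⁻¹ g⟩`. Inverting the rank-one perturbation explicitly
shows that `S` is the expression in braces in `I(k, U)` (`schurValue`, `pairForm_add_minimizer`,
`fibreForm_eq_square`).

The key statement is `groundEnergy_lt_iff_exists`: for `l < 0`, `E₀ < l` exactly when some `k`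
satisfies `m(k) - l < |v̂(k)|² S(k, l)`. No direct integral is needed: finitely supported states are
dense, their transforms are trigonometric polynomials, and their form is the average over `k` of the
fibre forms (`inner_sectorHamiltonian_sub`). If every bracket is nonnegative, so is this average.
Conversely, at a bad `k` a product `a(k)P(q)` is a trial state of negative energy: `P` approximates
the fibre minimizer (Weierstrass) and `|a|²` is a peak kernel near `k`.

By the variational principle `S` increases with `l`. Hence the limsup at `0⁻` exceeds `m(k)` exactly
when the strict inequality, including the extra `-l`, holds at some `l < 0`. This gives the
criterion at finite `U`; positivity of `S` and `m(0) = 0` settle the case `v̂(0) ≠ 0`. For `U → ∞`,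
`S` lies between its limit `S_∞` and `S_∞ + 25/U`, uniformly in `k` and `l`
(`pairSusceptibility_le`), and the slack `-l` absorbs the error. -/

/-- The closed box `[-π, π]²`. -/
def closedTorus : Set (ℝ × ℝ) :=
  Set.Icc (-Real.pi) Real.pi ×ˢ Set.Icc (-Real.pi) Real.pi

theorem isCompact_closedTorus : IsCompact closedTorus := isCompact_Icc.prod isCompact_Icc

theorem torus_ae_eq_closedTorus : torus =ᵐ[volume] closedTorus := by
  rw [Measure.volume_eq_prod]
  exact Measure.set_prod_ae_eq Ico_ae_eq_Icc Ico_ae_eq_Icc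

/-- The normalized Lebesgue measure on the torus. -/
def torusMeasure : Measure (ℝ × ℝ) :=
  ENNReal.ofReal (1 / (2 * Real.pi) ^ 2) • volume.restrict closedTorus

theorem integral_torusMeasure {E : Type*} [NormedAddCommGroup E] [NormedSpace ℝ E]
    (F : ℝ × ℝ → E) :
    ∫ q, F q ∂torusMeasure = (1 / (2 * Real.pi) ^ 2) • ∫ q in closedTorus, F q := by
  rw [torusMeasure, integral_smul_measure, ENNReal.toReal_ofReal (by positivity)]

theorem integral_torusMeasure_eq_torus (F : ℝ × ℝ → ℝ) :
    ∫ q, F q ∂torusMeasure = 1 / (2 * Real.pi) ^ 2 * ∫ q in torus, F q := by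
  rw [integral_torusMeasure, setIntegral_congr_set torus_ae_eq_closedTorus, smul_eq_mul]

theorem volume_closedTorus : volume closedTorus = ENNReal.ofReal ((2 * Real.pi) ^ 2) := by
  rw [closedTorus, Measure.volume_eq_prod, Measure.prod_prod, Real.volume_Icc,
    ← ENNReal.ofReal_mul (by linarith [Real.pi_pos])]
  congr 1
  ring

instance : IsProbabilityMeasure torusMeasure := by
  constructor
  rw [torusMeasure, Measure.smul_apply, Measure.restrict_apply_univ, volume_closedTorus,
    smul_eq_mul, ← ENNReal.ofReal_mul (by positivity), ← ENNReal.ofReal_one]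
  congr 1
  have := Real.pi_pos
  field_simp

theorem integrable_torusMeasure {E : Type*} [NormedAddCommGroup E]
    {F : ℝ × ℝ → E} (hF : Continuous F) : Integrable F torusMeasure :=
  (hF.continuousOn.integrableOn_compact isCompact_closedTorus).smul_measure ENNReal.ofReal_ne_top

theorem continuous_integral_torusMeasure {E : Type*} [NormedAddCommGroup E] [NormedSpace ℝ E]
    {F : ℝ × ℝ → ℝ × ℝ → E} (hF : Continuous F.uncurry) :
    Continuous fun k => ∫ q, F k q ∂torusMeasure := by
  simp only [integral_torusMeasure]
  exact (continuous_parametric_integral_of_continuous hF isCompact_closedTorus).const_smul _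

theorem integral_ofReal_torusMeasure (F : ℝ × ℝ → ℝ) :
    ∫ q, (F q : ℂ) ∂torusMeasure = ((∫ q, F q ∂torusMeasure : ℝ) : ℂ) := integral_ofReal

/-! ### Plane waves, their orthogonality, and lattice cosines -/

/-- The plane wave `e^{ik·x}`. -/
def wave (x : Site) (k : ℝ × ℝ) : ℂ :=
  Complex.exp (Complex.I * ((k.1 * x.1 + k.2 * x.2 : ℝ) : ℂ))

@[fun_prop]
theorem continuous_wave (x : Site) : Continuous (wave x) := by
  unfold wave; fun_prop

theorem wave_zero (k : ℝ × ℝ) : wave 0 k = 1 := by simp [wave]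

theorem wave_add (x y : Site) (k : ℝ × ℝ) : wave (x + y) k = wave x k * wave y k := by
  rw [wave, wave, wave, ← Complex.exp_add]
  congr 1
  simp
  ring

theorem wave_add_right (x : Site) (k q : ℝ × ℝ) : wave x (k + q) = wave x k * wave x q := by
  rw [wave, wave, wave, ← Complex.exp_add]
  congr 1
  simp
  ring

theorem conj_wave (x : Site) (k : ℝ × ℝ) : starRingEnd ℂ (wave x k) = wave (-x) k := by
  rw [wave, wave, ← Complex.exp_conj]
  congr 1
  simp
  ring

theorem wave_neg_right (x : Site) (k : ℝ × ℝ) : wave x (-k) = wave (-x) k := by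
  rw [wave, wave]
  congr 1
  simp

theorem norm_wave (x : Site) (k : ℝ × ℝ) : ‖wave x k‖ = 1 := by
  rw [wave, mul_comm, Complex.norm_exp_ofReal_mul_I]

theorem integral_exp_int_mul (n : ℤ) :
    ∫ t in Set.Icc (-Real.pi) Real.pi, Complex.exp (Complex.I * ((t * n : ℝ) : ℂ)) =
      if n = 0 then (2 * Real.pi : ℂ) else 0 := by
  have hp := Real.pi_pos
  rw [integral_Icc_eq_integral_Ioc, ← intervalIntegral.integral_of_le (by linarith)]
  split_ifs with h
  · subst h
    simp
    ring
  · have hc : Complex.I * n ≠ 0 := by simp [h]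
    have := integral_exp_mul_complex (a := -Real.pi) (b := Real.pi) hc
    have e : ∀ t : ℝ, Complex.I * ((t * n : ℝ) : ℂ) = Complex.I * n * t := by
      intro t; push_cast; ring
    simp only [e]
    rw [this, div_eq_zero_iff]
    left
    -- The primitive takes equal values at `±π`, because the two exponents differ by `n` periods
    -- `2πi`.
    rw [sub_eq_zero, Complex.exp_eq_exp_iff_exists_int]
    refine ⟨n, ?_⟩
    push_cast
    ring

theorem integral_wave (x : Site) :
    ∫ k, wave x k ∂torusMeasure = if x = 0 then 1 else 0 := by
  have hp := Real.pi_pos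
  have e : ∀ k : ℝ × ℝ, wave x k = Complex.exp (Complex.I * ((k.1 * x.1 : ℝ) : ℂ)) *
      Complex.exp (Complex.I * ((k.2 * x.2 : ℝ) : ℂ)) := by
    intro k
    rw [wave, ← Complex.exp_add]
    congr 1
    push_cast
    ring
  rw [integral_torusMeasure]
  simp only [e]
  rw [closedTorus, Measure.volume_eq_prod, setIntegral_prod_mul
    (fun t : ℝ => Complex.exp (Complex.I * ((t * x.1 : ℝ) : ℂ)))
    (fun t : ℝ => Complex.exp (Complex.I * ((t * x.2 : ℝ) : ℂ))),
    integral_exp_int_mul, integral_exp_int_mul]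
  obtain ⟨a, b⟩ := x
  by_cases ha : a = 0
  · by_cases hb : b = 0
    · have : (Real.pi : ℂ) ≠ 0 := by exact_mod_cast hp.ne'
      simp [ha, hb]
      field_simp
    · simp [ha, hb]
  · simp [ha]

theorem sum_unitVectors {M : Type*} [AddCommMonoid M] (f : Site → M) :
    ∑ z ∈ unitVectors, f z = f (1, 0) + (f (-1, 0) + (f (0, 1) + f (0, -1))) := by
  rw [unitVectors, Finset.sum_insert (by decide), Finset.sum_insert (by decide),
    Finset.sum_insert (by decide), Finset.sum_singleton]

theorem sum_wave (k : ℝ × ℝ) : ∑ z ∈ unitVectors, wave z k = 2 * (cos₂ k : ℂ) := by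
  rw [sum_unitVectors]
  simp only [wave, cos₂]
  push_cast
  simp only [Complex.cos]
  simp [mul_comm]
  ring

theorem sum_wave_neg (k : ℝ × ℝ) : ∑ z ∈ unitVectors, wave (-z) k = 2 * (cos₂ k : ℂ) := by
  rw [← sum_wave, sum_unitVectors, sum_unitVectors]
  simp
  abel

@[fun_prop]
theorem continuous_cos₂ : Continuous cos₂ := by
  unfold cos₂; fun_prop

theorem cos₂_neg (k : ℝ × ℝ) : cos₂ (-k) = cos₂ k := by simp [cos₂]

theorem cos₂_le (k : ℝ × ℝ) : cos₂ k ≤ 2 := by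
  unfold cos₂; linarith [Real.cos_le_one k.1, Real.cos_le_one k.2]

theorem neg_two_le_cos₂ (k : ℝ × ℝ) : -2 ≤ cos₂ k := by
  unfold cos₂; linarith [Real.neg_one_le_cos k.1, Real.neg_one_le_cos k.2]

/-! ### The quadratic form of a fibre -/

/-- The minimum of the fibre form, `⟨g, (d + U|1⟩⟨1|)⁻¹ g⟩`, in terms of the integrals
`rss = ∫ 1/d`, `rdd = ∫ g²/d`, `rsd = ∫ g/d`. -/
def schurValue (U rss rdd rsd : ℝ) : ℝ :=
  rdd / (1 + U * rss) + U * ((rdd * rss - rsd ^ 2) / (1 + U * rss))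

/-- This is the Sherman–Morrison form of `⟨g, (d + U|1⟩⟨1|)⁻¹ g⟩`: the unperturbed value `rdd` minus
a rank-one correction. -/
theorem schurValue_eq {U rss : ℝ} (hU : 0 ≤ U) (h : 0 ≤ rss) (rdd rsd : ℝ) :
    schurValue U rss rdd rsd = rdd - U * (rsd / (1 + U * rss)) * rsd := by
  have : 1 + U * rss ≠ 0 := by positivity
  unfold schurValue
  field_simp
  ring

/-- The form `⟨φ, (d + U|1⟩⟨1|) φ⟩`. -/
def pairForm (d : ℝ × ℝ → ℝ) (U : ℝ) (φ : ℝ × ℝ → ℂ) : ℝ :=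
  ∫ q, d q * ‖φ q‖ ^ 2 ∂torusMeasure + U * ‖∫ q, φ q ∂torusMeasure‖ ^ 2

theorem pairForm_nonneg {d : ℝ × ℝ → ℝ} (hd : ∀ q, 0 ≤ d q) {U : ℝ} (hU : 0 ≤ U)
    (φ : ℝ × ℝ → ℂ) : 0 ≤ pairForm d U φ := by
  have : 0 ≤ ∫ q, d q * ‖φ q‖ ^ 2 ∂torusMeasure :=
    integral_nonneg fun q => mul_nonneg (hd q) (by positivity)
  unfold pairForm
  positivity

theorem pairForm_mono {d d' : ℝ × ℝ → ℝ} (hd : Continuous d) (hd' : Continuous d')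
    (h : ∀ q, d q ≤ d' q) (U : ℝ) {φ : ℝ × ℝ → ℂ} (hφ : Continuous φ) :
    pairForm d U φ ≤ pairForm d' U φ := by
  unfold pairForm
  gcongr
  · exact integrable_torusMeasure (by fun_prop)
  · exact integrable_torusMeasure (by fun_prop)
  · exact fun q => mul_le_mul_of_nonneg_right (h q) (by positivity)

/-- The torus has mass one, so the form is controlled by the sup norm. A trial function uniformly
close to the exact minimizer therefore costs little. -/
theorem pairForm_le {d : ℝ × ℝ → ℝ} (hd : Continuous d) {C : ℝ} (hd0 : ∀ q, 0 ≤ d q)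
    (hC : ∀ q, d q ≤ C) {U : ℝ} (hU : 0 ≤ U) {φ : ℝ × ℝ → ℂ} (hφ : Continuous φ) {δ : ℝ}
    (hδ : ∀ q, ‖φ q‖ ≤ δ) : pairForm d U φ ≤ (C + U) * δ ^ 2 := by
  have h0 : 0 ≤ δ := (norm_nonneg _).trans (hδ 0)
  have hC0 : 0 ≤ C := (hd0 0).trans (hC 0)
  have h1 : ∫ q, d q * ‖φ q‖ ^ 2 ∂torusMeasure ≤ ∫ _q : ℝ × ℝ, C * δ ^ 2 ∂torusMeasure := by
    refine integral_mono (integrable_torusMeasure (by fun_prop)) (integrable_const _) fun q => ?_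
    have := hC q
    have := hδ q
    dsimp only
    gcongr
  have h2 : ‖∫ q, φ q ∂torusMeasure‖ ≤ δ := by
    simpa using norm_integral_le_of_norm_le_const (μ := torusMeasure) (ae_of_all _ hδ)
  rw [integral_const, probReal_univ, one_smul] at h1
  rw [pairForm, add_mul]
  gcongr

/-- The function `(d + U|1⟩⟨1|)⁻¹ g`. -/
def minimizer (d g : ℝ × ℝ → ℝ) (U : ℝ) (q : ℝ × ℝ) : ℝ :=
  (g q - U * ((∫ q, g q / d q ∂torusMeasure) /
    (1 + U * ∫ q, 1 / d q ∂torusMeasure))) / d q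

theorem continuous_minimizer {d g : ℝ × ℝ → ℝ} (hd : Continuous d) (hg : Continuous g)
    (hd0 : ∀ q, 0 < d q) (U : ℝ) : Continuous (minimizer d g U) := by
  unfold minimizer
  exact (hg.sub continuous_const).div hd fun q => (hd0 q).ne'

theorem pairForm_add (d : ℝ × ℝ → ℝ) (hd : Continuous d) (U : ℝ) {φ η : ℝ × ℝ → ℂ}
    (hφ : Continuous φ) (hη : Continuous η) :
    pairForm d U (fun q => φ q + η q) = pairForm d U φ + pairForm d U η +
      2 * (∫ q, (d q : ℂ) * (starRingEnd ℂ (η q) * φ q) ∂torusMeasure +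
        U * (starRingEnd ℂ (∫ q, η q ∂torusMeasure) * ∫ q, φ q ∂torusMeasure)).re := by
  have hn : ∀ a b : ℂ, ‖a + b‖ ^ 2 = ‖a‖ ^ 2 + ‖b‖ ^ 2 + 2 * (starRingEnd ℂ b * a).re := by
    intro a b
    rw [← Complex.normSq_eq_norm_sq, Complex.normSq_add, Complex.normSq_eq_norm_sq,
      Complex.normSq_eq_norm_sq, mul_comm a]
  have hre : (∫ q, (d q : ℂ) * (starRingEnd ℂ (η q) * φ q) ∂torusMeasure).re =
      ∫ q, d q * (starRingEnd ℂ (η q) * φ q).re ∂torusMeasure := by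
    have := integral_re (𝕜 := ℂ) (μ := torusMeasure)
      (f := fun q => (d q : ℂ) * (starRingEnd ℂ (η q) * φ q)) (integrable_torusMeasure (by fun_prop))
    simp only [RCLike.re_to_complex, Complex.re_ofReal_mul] at this
    exact this.symm
  unfold pairForm
  rw [integral_add (integrable_torusMeasure hφ) (integrable_torusMeasure hη), hn, Complex.add_re,
    Complex.re_ofReal_mul, hre]
  have : ∀ q, d q * ‖φ q + η q‖ ^ 2 = (d q * ‖φ q‖ ^ 2 + d q * ‖η q‖ ^ 2) +
      2 * (d q * (starRingEnd ℂ (η q) * φ q).re) := by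
    intro q; rw [hn]; ring
  simp only [this]
  rw [integral_add, integral_add, integral_const_mul]
  · ring
  all_goals exact integrable_torusMeasure (by fun_prop)

/-- The square is completed in the fibre form. -/
theorem pairForm_add_minimizer {d g : ℝ × ℝ → ℝ} (hd : Continuous d) (hg : Continuous g)
    (hd0 : ∀ q, 0 < d q) {U : ℝ} (hU : 0 ≤ U) {φ : ℝ × ℝ → ℂ} (hφ : Continuous φ) (t : ℂ) :
    pairForm d U (fun q => φ q + t * minimizer d g U q) =
      pairForm d U φ + 2 * (starRingEnd ℂ t * ∫ q, (g q : ℂ) * φ q ∂torusMeasure).re +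
      ‖t‖ ^ 2 * schurValue U (∫ q, 1 / d q ∂torusMeasure) (∫ q, g q ^ 2 / d q ∂torusMeasure)
        (∫ q, g q / d q ∂torusMeasure) := by
  have hi : Continuous fun q => 1 / d q := continuous_const.div hd fun q => (hd0 q).ne'
  have hgi : Continuous fun q => g q / d q := hg.div hd fun q => (hd0 q).ne'
  have hggi : Continuous fun q => g q ^ 2 / d q := (hg.pow 2).div hd fun q => (hd0 q).ne'
  have hss : 0 ≤ ∫ q, 1 / d q ∂torusMeasure :=
    integral_nonneg fun q => by have := hd0 q; positivity
  set ss := ∫ q, 1 / d q ∂torusMeasure with hss_def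
  set sd := ∫ q, g q / d q ∂torusMeasure with hsd_def
  set dd := ∫ q, g q ^ 2 / d q ∂torusMeasure with hdd_def
  -- `α` is the mean of the minimizer `f`. Averaging `f = (g - Uα)/d` gives the self-consistency
  -- equation `α = sd - Uα ss`, which fixes it.
  set α := sd / (1 + U * ss) with hα
  have hαe : sd - U * α * ss = α := by
    have : 1 + U * ss ≠ 0 := by positivity
    rw [hα]; field_simp; ring
  have hf : Continuous (minimizer d g U) := continuous_minimizer hd hg hd0 U
  have hm : ∀ q, minimizer d g U q = g q / d q - U * α * (1 / d q) := by
    intro q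
    rw [minimizer, ← hss_def, ← hsd_def, ← hα]
    ring
  -- This is the Euler–Lagrange equation `d f + U ∫ f = g`.
  have hdm : ∀ q, d q * minimizer d g U q = g q - U * α := by
    intro q
    have := (hd0 q).ne'
    rw [hm]; field_simp
  have hint : ∫ q, minimizer d g U q ∂torusMeasure = α := by
    simp only [hm]
    rw [integral_sub (integrable_torusMeasure hgi)
      ((integrable_torusMeasure hi).const_mul _), integral_const_mul, ← hss_def, ← hsd_def, hαe]
  have hsq : ∫ q, d q * minimizer d g U q ^ 2 ∂torusMeasure = dd - U * α * sd - U * α * α := by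
    have : ∀ q, d q * minimizer d g U q ^ 2 =
        (g q ^ 2 / d q - U * α * (g q / d q)) - U * α * minimizer d g U q := by
      intro q
      have h := hdm q
      have : d q * minimizer d g U q ^ 2 = (d q * minimizer d g U q) * minimizer d g U q := by ring
      rw [this, h, sub_mul]
      congr 1
      rw [hm]
      ring
    simp only [this]
    rw [integral_sub, integral_sub, integral_const_mul, integral_const_mul, hint]
    all_goals first
      | exact integrable_torusMeasure (by fun_prop)
  rw [pairForm_add d hd U hφ (by fun_prop), add_assoc, add_assoc, add_comm (2 * _)]
  congr 2
  · unfold pairForm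
    have h1 : ∀ q, d q * ‖t * (minimizer d g U q : ℂ)‖ ^ 2 =
        ‖t‖ ^ 2 * (d q * minimizer d g U q ^ 2) := by
      intro q
      rw [norm_mul, mul_pow, Complex.norm_real, Real.norm_eq_abs, sq_abs]
      ring
    simp only [h1]
    rw [integral_const_mul, hsq, integral_const_mul, integral_ofReal_torusMeasure, hint, norm_mul,
      mul_pow, Complex.norm_real, Real.norm_eq_abs, sq_abs, schurValue_eq hU hss, ← hα]
    ring
  -- By the Euler–Lagrange equation the cross term is `conj t ∫ gφ` minus a multiple of `∫ φ`, and
  -- that multiple cancels against the cross term of the rank-one part.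
  · have h2 : ∀ q, (d q : ℂ) * (starRingEnd ℂ (t * (minimizer d g U q : ℂ)) * φ q) =
        starRingEnd ℂ t * ((g q : ℂ) * φ q) - starRingEnd ℂ t * (U * α) * φ q := by
      intro q
      have h := congrArg (fun r : ℝ => (r : ℂ)) (hdm q)
      push_cast at h
      rw [map_mul, Complex.conj_ofReal]
      linear_combination (starRingEnd ℂ t * φ q) * h
    simp only [h2]
    rw [integral_sub, integral_const_mul, integral_const_mul, integral_const_mul,
      integral_ofReal_torusMeasure, hint, map_mul, Complex.conj_ofReal]
    · congr 2
      ring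
    all_goals exact integrable_torusMeasure (by fun_prop)

/-! ### The fibre at total momentum `k` and energy `l` -/

/-- The kinetic energy of a pair of total momentum `k`, measured from `l`. -/
def dispersion (ε : ℝ) (k : ℝ × ℝ) (l : ℝ) (q : ℝ × ℝ) : ℝ :=
  ε * (4 - cos₂ (q - k) - cos₂ q) - l

/-- The form factor of the pair `c_x`. -/
def formFactor (κ : ℝ) (k q : ℝ × ℝ) : ℝ := 1 + 2 * Real.exp (-κ) * cos₂ (q - k)

@[fun_prop]
theorem continuous_dispersion (ε : ℝ) (k : ℝ × ℝ) (l : ℝ) : Continuous (dispersion ε k l) := by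
  unfold dispersion; fun_prop

@[fun_prop]
theorem continuous_formFactor (κ : ℝ) (k : ℝ × ℝ) : Continuous (formFactor κ k) := by
  unfold formFactor; fun_prop

theorem neg_le_dispersion {ε : ℝ} (hε : 0 ≤ ε) (k : ℝ × ℝ) (l : ℝ) (q : ℝ × ℝ) :
    -l ≤ dispersion ε k l q := by
  have : 0 ≤ ε * (4 - cos₂ (q - k) - cos₂ q) :=
    mul_nonneg hε (by linarith [cos₂_le (q - k), cos₂_le q])
  unfold dispersion
  linarith

theorem dispersion_pos {ε : ℝ} (hε : 0 ≤ ε) (k : ℝ × ℝ) {l : ℝ} (hl : l < 0) (q : ℝ × ℝ) :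
    0 < dispersion ε k l q := by
  linarith [neg_le_dispersion hε k l q]

theorem dispersion_le {ε : ℝ} (hε : 0 ≤ ε) (k : ℝ × ℝ) (l : ℝ) (q : ℝ × ℝ) :
    dispersion ε k l q ≤ 8 * ε - l := by
  have : ε * (4 - cos₂ (q - k) - cos₂ q) ≤ ε * 8 :=
    mul_le_mul_of_nonneg_left (by linarith [neg_two_le_cos₂ (q - k), neg_two_le_cos₂ q]) hε
  unfold dispersion
  linarith

theorem abs_formFactor_le {κ : ℝ} (hκ : 0 < κ) (k q : ℝ × ℝ) : |formFactor κ k q| ≤ 5 := by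
  have h1 : Real.exp (-κ) ≤ 1 := Real.exp_le_one_iff.2 (by linarith)
  have h2 : |cos₂ (q - k)| ≤ 2 := abs_le.2 ⟨neg_two_le_cos₂ _, cos₂_le _⟩
  unfold formFactor
  calc |1 + 2 * Real.exp (-κ) * cos₂ (q - k)|
      ≤ |(1 : ℝ)| + |2 * Real.exp (-κ) * cos₂ (q - k)| := abs_add_le _ _
    _ = 1 + 2 * Real.exp (-κ) * |cos₂ (q - k)| := by
      rw [abs_one, abs_mul, abs_of_pos (by positivity : 0 < 2 * Real.exp (-κ))]
    _ ≤ 1 + 2 * 1 * 2 := by gcongr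
    _ = 5 := by norm_num

theorem Rss_eq (ε : ℝ) (k : ℝ × ℝ) (l : ℝ) :
    Rss ε k l = ∫ q, 1 / dispersion ε k l q ∂torusMeasure :=
  (integral_torusMeasure_eq_torus _).symm

theorem Rdd_eq (ε κ : ℝ) (k : ℝ × ℝ) (l : ℝ) :
    Rdd ε κ k l = ∫ q, formFactor κ k q ^ 2 / dispersion ε k l q ∂torusMeasure :=
  (integral_torusMeasure_eq_torus _).symm

theorem Rsd_eq (ε κ : ℝ) (k : ℝ × ℝ) (l : ℝ) :
    Rsd ε κ k l = ∫ q, formFactor κ k q / dispersion ε k l q ∂torusMeasure :=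
  (integral_torusMeasure_eq_torus _).symm

/-! ### The pair susceptibility: bounds in `U`, monotonicity, positivity -/

/-- The expression in braces in the definition of `I(k, U)`. -/
def pairSusceptibility (ε κ U : ℝ) (k : ℝ × ℝ) (l : ℝ) : ℝ :=
  schurValue U (Rss ε k l) (Rdd ε κ k l) (Rsd ε κ k l)

/-- The expression in the definition of `I(k, ∞)`. -/
def pairSusceptibilityInfinite (ε κ : ℝ) (k : ℝ × ℝ) (l : ℝ) : ℝ :=
  (Rdd ε κ k l * Rss ε k l - Rsd ε κ k l ^ 2) / Rss ε k l

theorem Rss_pos {ε : ℝ} (hε : 0 ≤ ε) (k : ℝ × ℝ) {l : ℝ} (hl : l < 0) : 0 < Rss ε k l := by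
  have hc : Continuous fun q => 1 / dispersion ε k l q :=
    continuous_const.div (by fun_prop) fun q => (dispersion_pos hε k hl q).ne'
  have h : ∫ _q : ℝ × ℝ, 1 / (8 * ε - l) ∂torusMeasure ≤
      ∫ q, 1 / dispersion ε k l q ∂torusMeasure :=
    integral_mono (integrable_const _) (integrable_torusMeasure hc) fun q =>
      one_div_le_one_div_of_le (dispersion_pos hε k hl q) (dispersion_le hε k l q)
  rw [integral_const, probReal_univ, one_smul, ← Rss_eq] at h
  have : 0 < 1 / (8 * ε - l) := one_div_pos.2 (by linarith)
  linarith

theorem abs_Rsd_le {ε : ℝ} (hε : 0 ≤ ε) {κ : ℝ} (hκ : 0 < κ) (k : ℝ × ℝ) {l : ℝ} (hl : l < 0) :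
    |Rsd ε κ k l| ≤ 5 * Rss ε k l := by
  have hc : Continuous fun q => 1 / dispersion ε k l q :=
    continuous_const.div (by fun_prop) fun q => (dispersion_pos hε k hl q).ne'
  rw [Rsd_eq, Rss_eq, ← integral_const_mul, ← Real.norm_eq_abs]
  refine norm_integral_le_of_norm_le ((integrable_torusMeasure hc).const_mul 5)
    (ae_of_all _ fun q => ?_)
  rw [Real.norm_eq_abs, abs_div, abs_of_pos (dispersion_pos hε k hl q), mul_one_div]
  have := dispersion_pos hε k hl q
  gcongr
  exact abs_formFactor_le hκ k q

theorem pairSusceptibility_sub {ε : ℝ} (hε : 0 ≤ ε) (κ : ℝ) {U : ℝ} (hU : 0 ≤ U) (k : ℝ × ℝ)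
    {l : ℝ} (hl : l < 0) :
    pairSusceptibility ε κ U k l - pairSusceptibilityInfinite ε κ k l =
      Rsd ε κ k l ^ 2 / (Rss ε k l * (1 + U * Rss ε k l)) := by
  have h := Rss_pos hε k hl
  rw [pairSusceptibility, schurValue_eq hU h.le, pairSusceptibilityInfinite]
  have : 1 + U * Rss ε k l ≠ 0 := by positivity
  field_simp
  ring

theorem pairSusceptibilityInfinite_le {ε : ℝ} (hε : 0 ≤ ε) (κ : ℝ) {U : ℝ} (hU : 0 ≤ U)
    (k : ℝ × ℝ) {l : ℝ} (hl : l < 0) :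
    pairSusceptibilityInfinite ε κ k l ≤ pairSusceptibility ε κ U k l := by
  have h := Rss_pos hε k hl
  have h' := pairSusceptibility_sub hε κ hU k hl
  have : 0 ≤ Rsd ε κ k l ^ 2 / (Rss ε k l * (1 + U * Rss ε k l)) := by positivity
  linarith

/-- Since `|Rsd| ≤ 5 Rss`, the difference `Rsd² / (Rss (1 + U Rss))` is at most `25 Rss² / (U
Rss²)`. The bound does not depend on the size of `Rss`, hence is uniform in `k` and in `l < 0`. -/
theorem pairSusceptibility_le {ε : ℝ} (hε : 0 ≤ ε) {κ : ℝ} (hκ : 0 < κ) {U : ℝ} (hU : 0 < U)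
    (k : ℝ × ℝ) {l : ℝ} (hl : l < 0) :
    pairSusceptibility ε κ U k l ≤ pairSusceptibilityInfinite ε κ k l + 25 / U := by
  have h := Rss_pos hε k hl
  have h' := pairSusceptibility_sub hε κ hU.le k hl
  have h2 : Rsd ε κ k l ^ 2 ≤ (5 * Rss ε k l) ^ 2 :=
    sq_le_sq' (neg_le_of_abs_le (abs_Rsd_le hε hκ k hl)) (le_of_abs_le (abs_Rsd_le hε hκ k hl))
  have : Rsd ε κ k l ^ 2 / (Rss ε k l * (1 + U * Rss ε k l)) ≤ 25 / U := by
    rw [div_le_div_iff₀ (by positivity) hU]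
    nlinarith [mul_le_mul_of_nonneg_right h2 hU.le]
  linarith

/-- The fibre form, completed to a square. -/
theorem fibreForm_eq {ε : ℝ} (hε : 0 ≤ ε) (κ : ℝ) {U : ℝ} (hU : 0 ≤ U) (k : ℝ × ℝ)
    {l : ℝ} (hl : l < 0) {φ : ℝ × ℝ → ℂ} (hφ : Continuous φ) (t : ℂ) :
    pairForm (dispersion ε k l) U φ +
        2 * (starRingEnd ℂ t * ∫ q, (formFactor κ k q : ℂ) * φ q ∂torusMeasure).re =
      pairForm (dispersion ε k l) U
        (fun q => φ q + t * minimizer (dispersion ε k l) (formFactor κ k) U q) -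
      ‖t‖ ^ 2 * pairSusceptibility ε κ U k l := by
  rw [pairForm_add_minimizer (by fun_prop) (by fun_prop) (dispersion_pos hε k hl) hU hφ,
    pairSusceptibility, Rss_eq, Rdd_eq, Rsd_eq]
  ring

/-- One half of a variational principle: dropping the completed square (with coupling `t = 1`) makes
every trial function a lower bound for the susceptibility. -/
theorem le_pairSusceptibility {ε : ℝ} (hε : 0 ≤ ε) (κ : ℝ) {U : ℝ} (hU : 0 ≤ U) (k : ℝ × ℝ)
    {l : ℝ} (hl : l < 0) {φ : ℝ × ℝ → ℂ} (hφ : Continuous φ) :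
    -(2 * (∫ q, (formFactor κ k q : ℂ) * φ q ∂torusMeasure).re) -
      pairForm (dispersion ε k l) U φ ≤ pairSusceptibility ε κ U k l := by
  have h := fibreForm_eq hε κ hU k hl hφ 1
  have h0 := pairForm_nonneg (fun q => (dispersion_pos hε k hl q).le) hU
    (fun q => φ q + 1 * minimizer (dispersion ε k l) (formFactor κ k) U q)
  rw [map_one, one_mul, norm_one, one_pow, one_mul] at h
  linarith

/-- Raising `l` lowers the dispersion. The optimizer at `l`, used as a trial function at `l'`,
therefore does at least as well there. -/
theorem pairSusceptibility_mono {ε : ℝ} (hε : 0 ≤ ε) (κ : ℝ) {U : ℝ} (hU : 0 ≤ U) (k : ℝ × ℝ)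
    {l l' : ℝ} (hl' : l' < 0) (hll' : l ≤ l') :
    pairSusceptibility ε κ U k l ≤ pairSusceptibility ε κ U k l' := by
  have hl : l < 0 := by linarith
  have hm := continuous_minimizer (continuous_dispersion ε k l) (continuous_formFactor κ k)
    (dispersion_pos hε k hl) U
  set f := minimizer (dispersion ε k l) (formFactor κ k) U
  have hφ : Continuous fun q => -(f q : ℂ) := by fun_prop
  have h := fibreForm_eq hε κ hU k hl hφ 1
  have h' := le_pairSusceptibility hε κ hU k hl' hφ
  have hle := pairForm_mono (continuous_dispersion ε k l') (continuous_dispersion ε k l)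
    (fun q => by unfold dispersion; linarith) U hφ
  -- At `φ = -f` the completed square vanishes, so the variational bound is attained at `l`.
  have h0 : pairForm (dispersion ε k l) U (fun q => -(f q : ℂ) + 1 * (f q : ℂ)) = 0 := by
    simp [pairForm]
  rw [h0, map_one, one_mul, norm_one, one_pow, one_mul] at h
  linarith

/-- Monotonicity survives the limit `U → ∞`, since the value at finite `U` differs from the limit by
at most `25 / U`. -/
theorem pairSusceptibilityInfinite_mono {ε : ℝ} (hε : 0 ≤ ε) {κ : ℝ} (hκ : 0 < κ) (k : ℝ × ℝ)
    {l l' : ℝ} (hl' : l' < 0) (hll' : l ≤ l') :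
    pairSusceptibilityInfinite ε κ k l ≤ pairSusceptibilityInfinite ε κ k l' := by
  have hl : l < 0 := by linarith
  have ht : Tendsto (fun U : ℝ => pairSusceptibilityInfinite ε κ k l' + 25 / U) atTop
      (𝓝 (pairSusceptibilityInfinite ε κ k l' + 0)) :=
    tendsto_const_nhds.add (tendsto_const_nhds.div_atTop tendsto_id)
  rw [add_zero] at ht
  refine ge_of_tendsto ht ?_
  filter_upwards [eventually_gt_atTop 0] with U hU
  exact (pairSusceptibilityInfinite_le hε κ hU.le k hl).trans
    ((pairSusceptibility_mono hε κ hU.le k hl' hll').trans (pairSusceptibility_le hε hκ hU k hl'))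

theorem integral_formFactor (κ : ℝ) (k : ℝ × ℝ) : ∫ q, formFactor κ k q ∂torusMeasure = 1 := by
  have h : ∀ q, ((formFactor κ k q : ℝ) : ℂ) =
      1 + ∑ z ∈ unitVectors, (Real.exp (-κ) * wave z (-k)) * wave z q := by
    intro q
    have h := sum_wave (q - k)
    simp only [sub_eq_add_neg q k, wave_add_right] at h
    rw [formFactor, sub_eq_add_neg q k]
    push_cast
    rw [mul_assoc, mul_left_comm, ← h, Finset.mul_sum]
    congr 1
    exact Finset.sum_congr rfl fun z _ => by ring
  have h2 : ((∫ q, formFactor κ k q ∂torusMeasure : ℝ) : ℂ) = 1 := by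
    rw [← integral_ofReal_torusMeasure]
    simp only [h]
    rw [integral_add (integrable_const _) (integrable_torusMeasure (by fun_prop)),
      integral_finsetSum _ fun z _ => integrable_torusMeasure (by fun_prop)]
    simp only [integral_const_mul, integral_wave]
    rw [Finset.sum_eq_zero]
    · simp
    · intro z hz
      have : z ≠ 0 := by
        rintro rfl
        revert hz
        decide
      simp [this]
  exact_mod_cast h2

/-- Use the constant trial function `-1/C`, with `C` an upper bound for the form on constants of
modulus one. As the form factor has mean one, the variational bound is at least `2/C - C/C² = 1/C`.
-/
theorem pairSusceptibility_pos {ε : ℝ} (hε : 0 ≤ ε) (κ : ℝ) {U : ℝ} (hU : 0 ≤ U) (k : ℝ × ℝ)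
    {l : ℝ} (hl : l < 0) : 0 < pairSusceptibility ε κ U k l := by
  set C := 8 * ε - l + U with hC
  have hC0 : 0 < C := by linarith
  have h := le_pairSusceptibility hε κ hU k hl (φ := fun _ => ((-1 / C : ℝ) : ℂ)) continuous_const
  have hle := pairForm_le (continuous_dispersion ε k l) (fun q => (dispersion_pos hε k hl q).le)
    (dispersion_le hε k l) hU (φ := fun _ => ((-1 / C : ℝ) : ℂ)) continuous_const (δ := 1 / C)
    (fun q => by
      rw [Complex.norm_real, Real.norm_eq_abs, neg_div, abs_neg, abs_of_pos (by positivity)])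
  rw [integral_mul_const, integral_ofReal_torusMeasure, integral_formFactor, Complex.ofReal_one,
    one_mul, Complex.ofReal_re] at h
  rw [← hC] at hle
  have e : C * (1 / C) ^ 2 = 1 / C := by field_simp
  have : 0 < 1 / C := by positivity
  rw [neg_div] at h hle
  linarith

/-! ### The Fourier transform of the coupling -/

theorem fourier_eq (v : Coupling) (k : ℝ × ℝ) :
    fourier v k = ∑' x : Site, (v x : ℂ) * wave (-x) k := by
  refine tsum_congr fun x => ?_
  rw [wave, mul_comm]
  congr 2
  push_cast [Prod.fst_neg, Prod.snd_neg]
  ring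

theorem norm_coupling_mul_wave (v : Coupling) (x y : Site) (k : ℝ × ℝ) :
    ‖(v x : ℂ) * wave y k‖ = ‖v x‖ := by
  rw [norm_mul, norm_wave, mul_one, Complex.norm_real]

theorem conj_fourier (v : Coupling) (hsym : ∀ x : ℤ × ℤ, v (-x) = v x) (k : ℝ × ℝ) :
    starRingEnd ℂ (fourier v k) = fourier v k := by
  rw [fourier_eq, Complex.conj_tsum, ← (Equiv.neg Site).tsum_eq]
  refine tsum_congr fun x => ?_
  rw [Equiv.neg_apply, map_mul, Complex.conj_ofReal, conj_wave, hsym, neg_neg]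

/-- The real part of the Fourier transform of the coupling. -/
def fourierRe (v : Coupling) (k : ℝ × ℝ) : ℝ := (fourier v k).re

theorem ofReal_fourierRe (v : Coupling) (hsym : ∀ x : ℤ × ℤ, v (-x) = v x) (k : ℝ × ℝ) :
    (fourierRe v k : ℂ) = fourier v k :=
  Complex.conj_eq_iff_re.1 (conj_fourier v hsym k)

theorem norm_fourier_sq (v : Coupling) (hsym : ∀ x : ℤ × ℤ, v (-x) = v x) (k : ℝ × ℝ) :
    ‖fourier v k‖ ^ 2 = fourierRe v k ^ 2 := by
  rw [← ofReal_fourierRe v hsym, Complex.norm_real, Real.norm_eq_abs, sq_abs]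

theorem continuous_fourier (v : Coupling) : Continuous (fourier v) := by
  have : fourier v = fun k => ∑' x : Site, (v x : ℂ) * wave (-x) k := funext (fourier_eq v)
  rw [this]
  exact continuous_tsum (fun x => by fun_prop) (summable_coupling v).norm
    fun x k => (norm_coupling_mul_wave v x (-x) k).le

@[fun_prop]
theorem continuous_fourierRe (v : Coupling) : Continuous (fourierRe v) :=
  Complex.continuous_re.comp (continuous_fourier v)

theorem norm_fourier_le (v : Coupling) (k : ℝ × ℝ) : ‖fourier v k‖ ≤ ∑' x, ‖v x‖ := by
  rw [fourier_eq]
  exact tsum_of_norm_bounded (summable_coupling v).norm.hasSum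
    fun x => (norm_coupling_mul_wave v x (-x) k).le

/-- Convolution with `v` becomes multiplication by its transform. Absolute summability of `v` allows
the sum and the integral to be exchanged, and evenness makes the multiplier real and fixes its sign
convention. -/
theorem tsum_coupling_mul_integral (v : Coupling) (hsym : ∀ x : ℤ × ℤ, v (-x) = v x)
    {A : ℝ × ℝ → ℂ} (hA : Continuous A) (x : Site) :
    ∑' w : Site, (v (x - w) : ℂ) * ∫ k, wave (-w) k * A k ∂torusMeasure =
      ∫ k, wave (-x) k * (fourierRe v k * A k) ∂torusMeasure := by
  have h := hasSum_integral_of_summable_integral_norm (μ := torusMeasure)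
    (F := fun (w : Site) k => (v (x - w) : ℂ) * (wave (-w) k * A k))
    (fun w => integrable_torusMeasure (by fun_prop)) (by
      simp only [norm_mul, norm_wave, Complex.norm_real, one_mul, integral_const_mul]
      exact ((Equiv.subLeft x).summable_iff.2 (summable_coupling v).norm).mul_right _)
  simp only [integral_const_mul] at h
  rw [h.tsum_eq]
  refine integral_congr_ae (ae_of_all _ fun k => ?_)
  dsimp only
  rw [ofReal_fourierRe v hsym, fourier_eq, ← tsum_mul_right, ← tsum_mul_left,
    ← (Equiv.addLeft x).tsum_eq]
  refine tsum_congr fun w => ?_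
  rw [Equiv.coe_addLeft, sub_add_cancel_left, hsym, neg_add, wave_add]
  ring

/-! ### Inverse Fourier transforms -/

/-- The wave function of a boson with Fourier transform `B`. -/
def bosonInv (B : ℝ × ℝ → ℂ) (x : Site) : ℂ := ∫ k, wave (-x) k * B k ∂torusMeasure

/-- The wave function of a pair with Fourier transform `F k q`, in terms of the total
momentum `k` and the momentum `q` of the second electron. -/
def pairInv (F : ℝ × ℝ → ℝ × ℝ → ℂ) (p : Site × Site) : ℂ :=
  ∫ k, ∫ q, wave (-p.1) (k - q) * wave (-p.2) q * F k q ∂torusMeasure ∂torusMeasure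

theorem continuous_inner_integral {F : ℝ × ℝ → ℝ × ℝ → ℂ} (hF : Continuous F.uncurry)
    (p : Site × Site) :
    Continuous fun k => ∫ q, wave (-p.1) (k - q) * wave (-p.2) q * F k q ∂torusMeasure := by
  refine continuous_integral_torusMeasure (F := fun k q =>
    wave (-p.1) (k - q) * wave (-p.2) q * F k q) ?_
  have : Continuous fun kq : (ℝ × ℝ) × (ℝ × ℝ) => F kq.1 kq.2 := hF
  simp only [Function.uncurry_def]
  fun_prop

theorem continuous_slice {F : ℝ × ℝ → ℝ × ℝ → ℂ} (hF : Continuous F.uncurry) (k : ℝ × ℝ) :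
    Continuous (F k) := hF.comp (by fun_prop : Continuous fun q => (k, q))

theorem bosonInv_add {A B : ℝ × ℝ → ℂ} (hA : Continuous A) (hB : Continuous B) (x : Site) :
    bosonInv (fun k => A k + B k) x = bosonInv A x + bosonInv B x := by
  simp only [bosonInv, mul_add]
  exact integral_add (integrable_torusMeasure (by fun_prop)) (integrable_torusMeasure (by fun_prop))

theorem bosonInv_const_mul (a : ℂ) (B : ℝ × ℝ → ℂ) (x : Site) :
    bosonInv (fun k => a * B k) x = a * bosonInv B x := by
  simp only [bosonInv, mul_left_comm _ a, integral_const_mul]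

theorem bosonInv_sum {ι : Type*} (s : Finset ι) {B : ι → ℝ × ℝ → ℂ} (hB : ∀ i, Continuous (B i))
    (x : Site) : bosonInv (fun k => ∑ i ∈ s, B i k) x = ∑ i ∈ s, bosonInv (B i) x := by
  simp only [bosonInv, Finset.mul_sum]
  exact integral_finsetSum _ fun i _ => integrable_torusMeasure (by have := hB i; fun_prop)

theorem bosonInv_wave_mul (z : Site) (B : ℝ × ℝ → ℂ) (x : Site) :
    bosonInv (fun k => wave (-z) k * B k) x = bosonInv B (x + z) := by
  simp only [bosonInv, neg_add, wave_add, mul_assoc]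

theorem pairInv_add {F G : ℝ × ℝ → ℝ × ℝ → ℂ} (hF : Continuous F.uncurry)
    (hG : Continuous G.uncurry) (p : Site × Site) :
    pairInv (fun k q => F k q + G k q) p = pairInv F p + pairInv G p := by
  simp only [pairInv, mul_add]
  rw [← integral_add (integrable_torusMeasure (continuous_inner_integral hF p))
    (integrable_torusMeasure (continuous_inner_integral hG p))]
  congr 1 with k
  have := continuous_slice hF k
  have := continuous_slice hG k
  exact integral_add (integrable_torusMeasure (by fun_prop)) (integrable_torusMeasure (by fun_prop))

theorem pairInv_const_mul (a : ℂ) (F : ℝ × ℝ → ℝ × ℝ → ℂ) (p : Site × Site) :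
    pairInv (fun k q => a * F k q) p = a * pairInv F p := by
  simp only [pairInv, mul_left_comm _ a, integral_const_mul]

theorem pairInv_sum {ι : Type*} (s : Finset ι) {F : ι → ℝ × ℝ → ℝ × ℝ → ℂ}
    (hF : ∀ i, Continuous (F i).uncurry) (p : Site × Site) :
    pairInv (fun k q => ∑ i ∈ s, F i k q) p = ∑ i ∈ s, pairInv (F i) p := by
  simp only [pairInv, Finset.mul_sum]
  rw [← integral_finsetSum _ fun i _ =>
    integrable_torusMeasure (continuous_inner_integral (hF i) p)]
  congr 1 with k
  exact integral_finsetSum _ fun i _ => integrable_torusMeasure (by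
    have := continuous_slice (hF i) k
    fun_prop)

theorem pairInv_wave_mul (z z' : Site) (F : ℝ × ℝ → ℝ × ℝ → ℂ) (p : Site × Site) :
    pairInv (fun k q => wave (-z) (k - q) * wave (-z') q * F k q) p =
      pairInv F (p.1 + z, p.2 + z') := by
  simp only [pairInv, neg_add, wave_add]
  congr 1 with k
  congr 1 with q
  ring

/-- The `k`-dependence sits at the first site and the `q`-dependence in the relative position, so
integrating over `q` detects the distance within the pair. -/
theorem wave_mul_wave_sub (x y : Site) (k q : ℝ × ℝ) :
    wave x (k - q) * wave y q = wave x k * wave (y - x) q := by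
  rw [sub_eq_add_neg k q, wave_add_right, wave_neg_right, sub_eq_add_neg y x, wave_add]
  ring

/-- A pair wave function concentrated at the relative distance `z`. -/
theorem pairInv_wave_mul_boson (z : Site) (B : ℝ × ℝ → ℂ) (p : Site × Site) :
    pairInv (fun k q => wave z (k - q) * B k) p = if p.1 = p.2 + z then bosonInv B p.2 else 0 := by
  obtain ⟨x, y⟩ := p
  have h : ∀ k q, wave (-x) (k - q) * wave (-y) q * (wave z (k - q) * B k) =
      wave (-x + z) k * B k * wave (-y - (-x + z)) q := by
    intro k q
    have := wave_mul_wave_sub (-x + z) (-y) k q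
    rw [wave_add (-x) z (k - q)] at this
    linear_combination B k * this
  simp only [pairInv, h, integral_const_mul, integral_wave]
  by_cases hx : x = y + z
  · subst hx
    simp [bosonInv]
  · have : ¬ (-y - (-x + z) = 0) := fun h0 => hx (by
      have : x - (y + z) = 0 := by rw [← h0]; abel
      exact sub_eq_zero.1 this)
    simp [hx, this]

/-- Integrating out `q` restricts a pair wave function to relative distance `z`: at coinciding sites
the two waves `-w` merge into one wave in `k`. -/
theorem bosonInv_inner_integral (z : Site) (F : ℝ × ℝ → ℝ × ℝ → ℂ) (w : Site) :
    bosonInv (fun k => ∫ q, wave (-z) (k - q) * F k q ∂torusMeasure) w =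
      pairInv F (w + z, w) := by
  simp only [bosonInv, pairInv, neg_add, wave_add, ← integral_const_mul]
  congr 1 with k
  congr 1 with q
  have := wave_mul_wave_sub (-w) (-w) k q
  rw [sub_self, wave_zero, mul_one] at this
  linear_combination (-(wave (-z) (k - q) * F k q)) * this

theorem formFactor_eq (κ : ℝ) (k q : ℝ × ℝ) : (formFactor κ k q : ℂ) =
    1 + Real.exp (-κ) * ∑ z ∈ unitVectors, wave z (k - q) := by
  rw [sum_wave, formFactor, ← cos₂_neg, neg_sub]
  push_cast
  ring

/-- The set of unit vectors is symmetric, so both signs are available: `wave z` serves for creating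
a pair from a boson, `wave (-z)` for annihilating a pair. -/
theorem formFactor_eq' (κ : ℝ) (k q : ℝ × ℝ) : (formFactor κ k q : ℂ) =
    1 + Real.exp (-κ) * ∑ z ∈ unitVectors, wave (-z) (k - q) := by
  rw [sum_wave_neg, formFactor, ← cos₂_neg, neg_sub]
  push_cast
  ring

theorem continuous_inner_integral' {F : ℝ × ℝ → ℝ × ℝ → ℂ} (hF : Continuous F.uncurry)
    (z : Site) : Continuous fun k => ∫ q, wave z (k - q) * F k q ∂torusMeasure := by
  refine continuous_integral_torusMeasure (F := fun k q => wave z (k - q) * F k q) ?_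
  have : Continuous fun kq : (ℝ × ℝ) × (ℝ × ℝ) => F kq.1 kq.2 := hF
  simp only [Function.uncurry_def]
  fun_prop

/-! ### The Hamiltonian in momentum space -/

/-- The kinetic energy of a boson of momentum `k`. -/
def bosonDispersion (ε hb : ℝ) (k : ℝ × ℝ) : ℝ := ε * hb * (2 - cos₂ k)

@[fun_prop]
theorem continuous_bosonDispersion (ε hb : ℝ) : Continuous (bosonDispersion ε hb) := by
  unfold bosonDispersion; fun_prop

/-- The Hamiltonian in momentum space, shifted by `l`: the pair component. -/
def fibrePair (ε κ U : ℝ) (v : Coupling) (l : ℝ) (F : ℝ × ℝ → ℝ × ℝ → ℂ) (B : ℝ × ℝ → ℂ)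
    (k q : ℝ × ℝ) : ℂ :=
  dispersion ε k l q * F k q + U * ∫ q', F k q' ∂torusMeasure +
    formFactor κ k q * (fourierRe v k * B k)

/-- The Hamiltonian in momentum space, shifted by `l`: the boson component. -/
def fibreBoson (ε hb κ : ℝ) (v : Coupling) (l : ℝ) (F : ℝ × ℝ → ℝ × ℝ → ℂ) (B : ℝ × ℝ → ℂ)
    (k : ℝ × ℝ) : ℂ :=
  (bosonDispersion ε hb k - l : ℝ) * B k +
    fourierRe v k * ∫ q, formFactor κ k q * F k q ∂torusMeasure

theorem pairAction_inv (ε κ U : ℝ) (v : Coupling) (hsym : ∀ x : ℤ × ℤ, v (-x) = v x) (l : ℝ)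
    {F : ℝ × ℝ → ℝ × ℝ → ℂ} {B : ℝ × ℝ → ℂ} (hF : Continuous F.uncurry) (hB : Continuous B)
    (p : Site × Site) :
    pairAction ε κ U (fun x => v x) (pairInv F) (bosonInv B) p - l * pairInv F p =
      pairInv (fibrePair ε κ U v l F B) p := by
  have hF' : Continuous fun kq : (ℝ × ℝ) × (ℝ × ℝ) => F kq.1 kq.2 := hF
  have hI : Continuous fun k => ∫ q, F k q ∂torusMeasure := continuous_integral_torusMeasure hF
  have hI' : Continuous fun kq : (ℝ × ℝ) × (ℝ × ℝ) => ∫ q, F kq.1 q ∂torusMeasure :=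
    hI.comp continuous_fst
  set A : ℝ × ℝ → ℂ := fun k => fourierRe v k * B k with hA
  have hAc : Continuous A := by fun_prop
  have hconv : ∑' w : Site, (v (w - p.2) : ℂ) * bosonInv B w = bosonInv A p.2 := by
    rw [hA, bosonInv, ← tsum_coupling_mul_integral v hsym hB]
    refine tsum_congr fun w => ?_
    rw [← hsym, neg_sub]
    rfl
  -- Expand every multiplier into plane waves: those acting on `F` invert to shifts, and those
  -- multiplying a function of `k` alone invert to pairs at a fixed relative distance.
  have hexp : fibrePair ε κ U v l F B = fun k q =>
      (((((-(ε / 2) : ℝ) : ℂ) * ∑ z ∈ unitVectors, wave (-z) (k - q) * wave (-0) q * F k q)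
      + ((-(ε / 2) : ℝ) : ℂ) * ∑ z ∈ unitVectors, wave (-0) (k - q) * wave (-z) q * F k q)
      + ((4 * ε - l : ℝ) : ℂ) * F k q)
      + (U : ℂ) * (wave 0 (k - q) * ∫ q', F k q' ∂torusMeasure)
      + (wave 0 (k - q) * A k + (Real.exp (-κ) : ℂ) * ∑ z ∈ unitVectors, wave z (k - q) * A k) := by
    funext k q
    simp only [neg_zero, wave_zero, mul_one, one_mul]
    rw [← Finset.sum_mul, ← Finset.sum_mul, ← Finset.sum_mul, fibrePair, sum_wave_neg,
      sum_wave_neg, formFactor_eq, dispersion, ← cos₂_neg, neg_sub]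
    push_cast
    ring
  have c0 : ∀ z z' : Site, Continuous (Function.uncurry fun k q : ℝ × ℝ =>
      wave (-z) (k - q) * wave (-z') q * F k q) := by
    intro z z'; simp only [Function.uncurry_def]; fun_prop
  have c1 : ∀ z : Site, Continuous (Function.uncurry fun k q : ℝ × ℝ => wave z (k - q) * A k) := by
    intro z; simp only [Function.uncurry_def]; fun_prop
  -- The Hubbard term: averaging over `q` and transforming back restricts the pair to the diagonal.
  have hI0 : (if p.1 = p.2 + 0 then bosonInv (fun k => ∫ q, F k q ∂torusMeasure) p.2 else 0) =
      if p.1 = p.2 then pairInv F p else 0 := by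
    rw [add_zero]
    split_ifs with h
    · have := bosonInv_inner_integral 0 F p.2
      simp only [neg_zero, wave_zero, one_mul, add_zero] at this
      exact this.trans (congrArg _ (Prod.ext h.symm rfl))
    · rfl
  rw [hexp, pairInv_add, pairInv_add, pairInv_add, pairInv_add, pairInv_add, pairInv_const_mul,
    pairInv_const_mul, pairInv_const_mul, pairInv_const_mul, pairInv_const_mul,
    pairInv_sum _ (fun z => c0 z 0), pairInv_sum _ (fun z => c0 0 z), pairInv_sum _ c1,
    pairInv_wave_mul_boson, pairInv_wave_mul_boson, hI0, pairAction, hconv]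
  · simp only [pairInv_wave_mul, pairInv_wave_mul_boson, add_zero]
    have h4 : (∑ z ∈ unitVectors, if p.1 = p.2 + z then bosonInv A p.2 else 0) =
        bosonInv A p.2 * ∑ z ∈ unitVectors, if p.1 = p.2 + z then 1 else 0 := by
      rw [Finset.mul_sum]
      exact Finset.sum_congr rfl fun z _ => by split_ifs <;> simp
    rw [h4]
    by_cases h : p.1 = p.2
    · simp only [h, if_true]
      push_cast
      ring
    · simp only [h, if_false]
      push_cast
      ring
  all_goals
    simp only [Function.uncurry_def]
    fun_prop

theorem bosonAction_inv (ε hb κ : ℝ) (v : Coupling) (hsym : ∀ x : ℤ × ℤ, v (-x) = v x) (l : ℝ)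
    {F : ℝ × ℝ → ℝ × ℝ → ℂ} {B : ℝ × ℝ → ℂ} (hF : Continuous F.uncurry) (hB : Continuous B)
    (x : Site) :
    bosonAction ε hb κ (fun x => v x) (pairInv F) (bosonInv B) x - l * bosonInv B x =
      bosonInv (fibreBoson ε hb κ v l F B) x := by
  have hF' : Continuous fun kq : (ℝ × ℝ) × (ℝ × ℝ) => F kq.1 kq.2 := hF
  -- `D` is the transform of the boson wave function left when the pair operator `c_x` annihilates
  -- the pair; `hDi` identifies it in position space.
  set D : ℝ × ℝ → ℂ := fun k => ∫ q, formFactor κ k q * F k q ∂torusMeasure with hD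
  have hDe : ∀ k, D k = ∫ q, wave (-0) (k - q) * F k q ∂torusMeasure +
      (Real.exp (-κ) : ℂ) * ∑ z ∈ unitVectors, ∫ q, wave (-z) (k - q) * F k q ∂torusMeasure := by
    intro k
    have hk := continuous_slice hF k
    have h : ∀ q, (formFactor κ k q : ℂ) * F k q = wave (-0) (k - q) * F k q +
        (Real.exp (-κ) : ℂ) * ∑ z ∈ unitVectors, wave (-z) (k - q) * F k q := by
      intro q
      rw [formFactor_eq', ← Finset.sum_mul, neg_zero, wave_zero]
      ring
    simp only [hD, h]
    rw [integral_add (integrable_torusMeasure (by fun_prop))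
      (integrable_torusMeasure (by fun_prop)), integral_const_mul,
      integral_finsetSum _ fun z _ => integrable_torusMeasure (by fun_prop)]
  have hDc : Continuous D := by
    rw [funext hDe]
    have := continuous_inner_integral' hF
    fun_prop
  have hDi : ∀ w, bosonInv D w = pairInv F (w, w) +
      Real.exp (-κ) * ∑ z ∈ unitVectors, pairInv F (w + z, w) := by
    intro w
    have hc := continuous_inner_integral' hF
    rw [funext hDe, bosonInv_add (hc _) (by fun_prop), bosonInv_const_mul,
      bosonInv_sum _ (fun z => hc (-z))]
    simp only [bosonInv_inner_integral, add_zero]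
  have hconv : ∑' w : Site, (v (x - w) : ℂ) * bosonInv D w =
      bosonInv (fun k => fourierRe v k * D k) x := by
    rw [bosonInv, ← tsum_coupling_mul_integral v hsym hDc]
    rfl
  have hexp : fibreBoson ε hb κ v l F B = fun k =>
      (((-(ε * hb / 2) : ℝ) : ℂ) * ∑ z ∈ unitVectors, wave (-z) k * B k)
      + ((2 * (ε * hb) - l : ℝ) : ℂ) * B k + fourierRe v k * D k := by
    funext k
    rw [← Finset.sum_mul, fibreBoson, sum_wave_neg, bosonDispersion]
    push_cast
    ring
  rw [hexp, bosonInv_add (by fun_prop) (by fun_prop), bosonInv_add (by fun_prop) (by fun_prop),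
    bosonInv_const_mul, bosonInv_const_mul, bosonInv_sum _ (fun z => by fun_prop), bosonAction,
    ← hconv]
  simp only [hDi, bosonInv_wave_mul]
  push_cast
  ring

/-! ### Finitely supported wave functions -/

/-- A finitely supported function as an element of `ℓ²`. -/
def ofFinsupp {α : Type} [DecidableEq α] (c : α →₀ ℂ) : lp (fun _ : α => ℂ) 2 :=
  ∑ i ∈ c.support, lp.single 2 i (c i)

theorem inner_ofFinsupp {α : Type} [DecidableEq α] (c : α →₀ ℂ) (f : lp (fun _ : α => ℂ) 2) :
    inner ℂ (ofFinsupp c) f = ∑ i ∈ c.support, starRingEnd ℂ (c i) * f i := by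
  rw [ofFinsupp, sum_inner]
  refine Finset.sum_congr rfl fun i _ => ?_
  rw [lp.inner_single_left, RCLike.inner_apply, mul_comm]

theorem ofFinsupp_apply {α : Type} [DecidableEq α] (c : α →₀ ℂ) (i : α) :
    ofFinsupp c i = c i := by
  have h := inner_ofFinsupp c (lp.single 2 i (1 : ℂ))
  rw [lp.inner_single_right, RCLike.inner_apply, one_mul] at h
  have h' := congrArg (starRingEnd ℂ) h
  rw [Complex.conj_conj, map_sum] at h'
  rw [h']
  simp only [lp.single_apply, Pi.single_apply, mul_ite, mul_one, mul_zero, apply_ite (starRingEnd ℂ),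
    Complex.conj_conj, map_zero, Finset.sum_ite_eq', Finsupp.mem_support_iff]
  by_cases h0 : c i = 0 <;> simp [h0]

theorem denseRange_ofFinsupp {α : Type} [DecidableEq α] :
    DenseRange (ofFinsupp : (α →₀ ℂ) → lp (fun _ : α => ℂ) 2) := by
  intro f
  refine mem_closure_of_tendsto (lp.hasSum_single (p := 2) (by norm_num) f)
    (Eventually.of_forall fun s => ⟨Finsupp.onFinset s (fun i => if i ∈ s then f i else 0)
      (by intro a; simp +contextual), ?_⟩)
  have : ∀ i, ofFinsupp (Finsupp.onFinset s (fun i => if i ∈ s then f i else 0)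
      (by intro a; simp +contextual)) i = (∑ j ∈ s, lp.single 2 j (f j)) i := by
    intro i
    rw [ofFinsupp_apply, Finsupp.onFinset_apply, lp.coeFn_sum, Finset.sum_apply]
    simp [lp.single_apply, Pi.single_apply]
  exact lp.ext (funext this)

/-- A finitely supported state of the sector. -/
def sectorOfFinsupp (c : (Site × Site →₀ ℂ) × (Site →₀ ℂ)) : SectorSpace :=
  WithLp.toLp 2 (ofFinsupp c.1, ofFinsupp c.2)

theorem denseRange_sectorOfFinsupp : DenseRange sectorOfFinsupp :=
  (WithLp.prodContinuousLinearEquiv 2 ℂ PairSpace BosonSpace).symm.surjective.denseRange.comp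
    (denseRange_ofFinsupp.prodMap denseRange_ofFinsupp)
    (WithLp.prodContinuousLinearEquiv 2 ℂ PairSpace BosonSpace).symm.continuous

/-- The Fourier transform of a finitely supported boson wave function. -/
def bosonHat (b : Site →₀ ℂ) (k : ℝ × ℝ) : ℂ := ∑ x ∈ b.support, b x * wave x k

/-- The Fourier transform of a finitely supported pair wave function. -/
def pairHat (c : Site × Site →₀ ℂ) (k q : ℝ × ℝ) : ℂ :=
  ∑ p ∈ c.support, c p * (wave p.1 (k - q) * wave p.2 q)

@[fun_prop]
theorem continuous_bosonHat (b : Site →₀ ℂ) : Continuous (bosonHat b) := by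
  unfold bosonHat; fun_prop

theorem continuous_pairHat (c : Site × Site →₀ ℂ) : Continuous (pairHat c).uncurry := by
  simp only [Function.uncurry_def, pairHat]; fun_prop

theorem bosonInv_bosonHat (b : Site →₀ ℂ) (x : Site) : bosonInv (bosonHat b) x = b x := by
  have h : bosonHat b = fun k => ∑ y ∈ b.support, b y * wave y k := rfl
  rw [h, bosonInv_sum _ (fun y => by fun_prop)]
  have h1 : ∀ y, bosonInv (fun k => b y * wave y k) x = if x = y then b y else 0 := by
    intro y
    rw [bosonInv_const_mul, bosonInv]
    simp only [← wave_add, integral_wave, neg_add_eq_zero, mul_ite, mul_one, mul_zero]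
  simp only [h1, Finset.sum_ite_eq, Finsupp.mem_support_iff]
  by_cases h0 : b x = 0 <;> simp [h0]

theorem pairInv_pairHat (c : Site × Site →₀ ℂ) (p : Site × Site) :
    pairInv (pairHat c) p = c p := by
  have h : pairHat c = fun k q => ∑ r ∈ c.support, c r * (wave r.1 (k - q) * wave r.2 q) := rfl
  rw [h, pairInv_sum _ (fun y => by simp only [Function.uncurry_def]; fun_prop)]
  have h1 : ∀ r : Site × Site, pairInv (fun k q => c r * (wave r.1 (k - q) * wave r.2 q)) p =
      if p = r then c r else 0 := by
    intro r
    have e : ∀ k q, wave (-p.1) (k - q) * wave (-p.2) q * (wave r.1 (k - q) * wave r.2 q) =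
        wave (-p.1 + r.1) k * wave (-p.2 + r.2 - (-p.1 + r.1)) q := by
      intro k q
      rw [← wave_mul_wave_sub, wave_add, wave_add]
      ring
    rw [pairInv_const_mul, pairInv]
    simp only [e, integral_const_mul, integral_mul_const, integral_wave]
    by_cases hp : p = r
    · subst hp; simp
    · rw [if_neg hp]
      by_cases h1 : p.1 = r.1
      · have h2 : p.2 ≠ r.2 := fun h2 => hp (Prod.ext h1 h2)
        simp [h1, neg_add_eq_zero, h2]
      · simp [neg_add_eq_zero, h1]
  simp only [h1, Finset.sum_ite_eq, Finsupp.mem_support_iff]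
  by_cases h0 : c p = 0 <;> simp [h0]

/-- A Parseval identity with one finitely supported factor. The sum is finite, so linearity of the
integral suffices and no `L²` theory enters. -/
theorem sum_conj_mul_bosonInv (b : Site →₀ ℂ) {B : ℝ × ℝ → ℂ} (hB : Continuous B) :
    ∑ x ∈ b.support, starRingEnd ℂ (b x) * bosonInv B x =
      ∫ k, starRingEnd ℂ (bosonHat b k) * B k ∂torusMeasure := by
  simp only [bosonInv, bosonHat, map_sum, Finset.sum_mul, ← integral_const_mul, map_mul, conj_wave,
    mul_assoc]
  exact (integral_finsetSum _ fun x _ => integrable_torusMeasure (by fun_prop)).symm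

theorem sum_conj_mul_pairInv (c : Site × Site →₀ ℂ) {F : ℝ × ℝ → ℝ × ℝ → ℂ}
    (hF : Continuous F.uncurry) :
    ∑ p ∈ c.support, starRingEnd ℂ (c p) * pairInv F p =
      ∫ k, ∫ q, starRingEnd ℂ (pairHat c k q) * F k q ∂torusMeasure ∂torusMeasure := by
  have h : ∀ k, ∫ q, starRingEnd ℂ (pairHat c k q) * F k q ∂torusMeasure =
      ∑ p ∈ c.support, starRingEnd ℂ (c p) *
        ∫ q, wave (-p.1) (k - q) * wave (-p.2) q * F k q ∂torusMeasure := by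
    intro k
    have := continuous_slice hF k
    simp only [pairHat, map_sum, Finset.sum_mul, ← integral_const_mul, map_mul, conj_wave, mul_assoc]
    exact integral_finsetSum _ fun x _ => integrable_torusMeasure (by fun_prop)
  simp only [h, pairInv, ← integral_const_mul]
  have hc := continuous_inner_integral hF
  exact (integral_finsetSum _ fun p _ => integrable_torusMeasure (by
    have := hc p
    simp only [integral_const_mul]
    fun_prop)).symm

/-! ### The quadratic form of the Hamiltonian -/

/-- The sector Hamiltonian is only chosen through its action on Fock space. Injectivity of `embed`
identifies it with the explicit operator of `exists_coordinates`. -/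
theorem sectorHamiltonian_coordinates (ε hb κ : ℝ) (v : Coupling) (U : ℝ) (Ψ : SectorSpace) :
    (∀ p, (sectorHamiltonian ε hb κ v U Ψ).fst p =
      pairAction ε κ U (fun x => v x) (fun p => Ψ.fst p) (fun x => Ψ.snd x) p) ∧
    (∀ x, (sectorHamiltonian ε hb κ v U Ψ).snd x =
      bosonAction ε hb κ (fun x => v x) (fun p => Ψ.fst p) (fun x => Ψ.snd x) x) := by
  obtain ⟨T, hT⟩ := exists_coordinates ε hb κ U (fun x => v x) (summable_coupling v)
  have h : sectorHamiltonian ε hb κ v U Ψ = T Ψ := embed_injective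
    ((hamiltonian_embed_eq ε hb κ v U Ψ).symm.trans
      (hamiltonian_embed ε hb κ U (fun x => v x) Ψ (T Ψ) (hT Ψ).1 (hT Ψ).2))
  rw [h]
  exact hT Ψ

/-- The form of the Hamiltonian, shifted by `l`, in the fibre of total momentum `k`. -/
def fibreForm (ε hb κ U : ℝ) (v : Coupling) (l : ℝ) (k : ℝ × ℝ) (φ : ℝ × ℝ → ℂ) (β : ℂ) : ℝ :=
  pairForm (dispersion ε k l) U φ +
    2 * (starRingEnd ℂ (fourierRe v k * β) *
      ∫ q, (formFactor κ k q : ℂ) * φ q ∂torusMeasure).re +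
    ‖β‖ ^ 2 * (bosonDispersion ε hb k - l)

theorem ofReal_fibreForm (ε hb κ U : ℝ) (v : Coupling) (l : ℝ) (k : ℝ × ℝ)
    {F : ℝ × ℝ → ℝ × ℝ → ℂ} (hF : Continuous F.uncurry) (B : ℝ × ℝ → ℂ) :
    (fibreForm ε hb κ U v l k (F k) (B k) : ℂ) =
      ∫ q, starRingEnd ℂ (F k q) * fibrePair ε κ U v l F B k q ∂torusMeasure +
        starRingEnd ℂ (B k) * fibreBoson ε hb κ v l F B k := by
  have hk := continuous_slice hF k
  have hsq : ∀ a : ℂ, starRingEnd ℂ a * a = ((‖a‖ ^ 2 : ℝ) : ℂ) := by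
    intro a; rw [mul_comm, Complex.mul_conj, Complex.normSq_eq_norm_sq]
  have e : ∀ q, starRingEnd ℂ (F k q) * fibrePair ε κ U v l F B k q =
      ((dispersion ε k l q * ‖F k q‖ ^ 2 : ℝ) : ℂ) +
      starRingEnd ℂ (F k q) * (U * ∫ q', F k q' ∂torusMeasure) +
      starRingEnd ℂ (formFactor κ k q * F k q) * (fourierRe v k * B k) := by
    intro q
    rw [Complex.ofReal_mul, ← hsq, fibrePair, map_mul, Complex.conj_ofReal]
    ring
  simp only [e]
  rw [integral_add (integrable_torusMeasure (by fun_prop)) (integrable_torusMeasure (by fun_prop)),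
    integral_add (integrable_torusMeasure (by fun_prop)) (integrable_torusMeasure (by fun_prop)),
    integral_mul_const, integral_mul_const, integral_conj, integral_conj,
    integral_ofReal_torusMeasure, fibreBoson, fibreForm, pairForm]
  set D := ∫ q, (formFactor κ k q : ℂ) * F k q ∂torusMeasure
  set J := ∫ q, F k q ∂torusMeasure
  have h1 : starRingEnd ℂ J * (U * J) = U * ((‖J‖ ^ 2 : ℝ) : ℂ) := by
    rw [← hsq]; ring
  have h2 : starRingEnd ℂ (B k) * (((bosonDispersion ε hb k - l : ℝ) : ℂ) * B k) =
      ((‖B k‖ ^ 2 : ℝ) : ℂ) * (bosonDispersion ε hb k - l : ℝ) := by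
    rw [← hsq]; ring
  -- The two exchange terms are conjugates of each other and add up to twice a real part.
  have h3 := Complex.add_conj (starRingEnd ℂ (fourierRe v k * B k) * D)
  rw [map_mul (starRingEnd ℂ) _ D, Complex.conj_conj, map_mul, Complex.conj_ofReal] at h3
  rw [h1, mul_add, h2, map_mul, Complex.conj_ofReal]
  push_cast at h3 ⊢
  linear_combination -h3

/-- The fibre decomposition at the level of forms: a finitely supported state is the inverse
transform of a trigonometric polynomial, the operator acts on it fibrewise, and Parseval turns the
inner product into an average over `k`. -/
theorem inner_sectorHamiltonian_sub (ε hb κ : ℝ) (v : Coupling)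
    (hsym : ∀ x : ℤ × ℤ, v (-x) = v x) (U l : ℝ) (c : (Site × Site →₀ ℂ) × (Site →₀ ℂ)) :
    inner ℂ (sectorOfFinsupp c) (sectorHamiltonian ε hb κ v U (sectorOfFinsupp c) -
        (l : ℂ) • sectorOfFinsupp c) =
      ((∫ k, fibreForm ε hb κ U v l k (pairHat c.1 k) (bosonHat c.2 k) ∂torusMeasure : ℝ) : ℂ) := by
  have hF := continuous_pairHat c.1
  have hF' : Continuous fun kq : (ℝ × ℝ) × (ℝ × ℝ) => pairHat c.1 kq.1 kq.2 := hF
  have hB := continuous_bosonHat c.2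
  have hI : Continuous fun k => ∫ q, pairHat c.1 k q ∂torusMeasure :=
    continuous_integral_torusMeasure hF
  have hI' : Continuous fun kq : (ℝ × ℝ) × (ℝ × ℝ) => ∫ q, pairHat c.1 kq.1 q ∂torusMeasure :=
    hI.comp continuous_fst
  have hD : Continuous fun k => ∫ q, formFactor κ k q * pairHat c.1 k q ∂torusMeasure :=
    continuous_integral_torusMeasure
      (F := fun k q => (formFactor κ k q : ℂ) * pairHat c.1 k q)
      (by simp only [Function.uncurry_def, formFactor]; fun_prop)
  have hFP : Continuous (fibrePair ε κ U v l (pairHat c.1) (bosonHat c.2)).uncurry := by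
    simp only [Function.uncurry_def, fibrePair, formFactor, dispersion]
    fun_prop
  have hFB : Continuous (fibreBoson ε hb κ v l (pairHat c.1) (bosonHat c.2)) := by
    unfold fibreBoson
    fun_prop
  obtain ⟨h1, h2⟩ := sectorHamiltonian_coordinates ε hb κ v U (sectorOfFinsupp c)
  have e1 : (fun p => (sectorOfFinsupp c).fst p) = pairInv (pairHat c.1) := by
    funext p; rw [pairInv_pairHat]; exact ofFinsupp_apply c.1 p
  have e2 : (fun x => (sectorOfFinsupp c).snd x) = bosonInv (bosonHat c.2) := by
    funext x; rw [bosonInv_bosonHat]; exact ofFinsupp_apply c.2 x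
  rw [WithLp.prod_inner_apply]
  have g1 : ∀ p, (sectorHamiltonian ε hb κ v U (sectorOfFinsupp c) -
      (l : ℂ) • sectorOfFinsupp c).fst p =
        pairInv (fibrePair ε κ U v l (pairHat c.1) (bosonHat c.2)) p := by
    intro p
    rw [← pairAction_inv ε κ U v hsym l hF hB, ← e1, ← e2, ← h1]
    rfl
  have g2 : ∀ x, (sectorHamiltonian ε hb κ v U (sectorOfFinsupp c) -
      (l : ℂ) • sectorOfFinsupp c).snd x =
        bosonInv (fibreBoson ε hb κ v l (pairHat c.1) (bosonHat c.2)) x := by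
    intro x
    rw [← bosonAction_inv ε hb κ v hsym l hF hB, ← e1, ← e2, ← h2]
    rfl
  have i1 := inner_ofFinsupp c.1 (sectorHamiltonian ε hb κ v U (sectorOfFinsupp c) -
      (l : ℂ) • sectorOfFinsupp c).fst
  have i2 := inner_ofFinsupp c.2 (sectorHamiltonian ε hb κ v U (sectorOfFinsupp c) -
      (l : ℂ) • sectorOfFinsupp c).snd
  simp only [g1] at i1
  simp only [g2] at i2
  rw [sum_conj_mul_pairInv _ hFP] at i1
  rw [sum_conj_mul_bosonInv _ hFB] at i2
  refine (congrArg₂ (· + ·) i1 i2).trans ?_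
  rw [← integral_ofReal_torusMeasure]
  simp only [ofReal_fibreForm ε hb κ U v l _ hF]
  refine (integral_add (integrable_torusMeasure ?_) (integrable_torusMeasure (by fun_prop))).symm
  refine continuous_integral_torusMeasure (F := fun k q => starRingEnd ℂ (pairHat c.1 k q) *
    fibrePair ε κ U v l (pairHat c.1) (bosonHat c.2) k q) ?_
  have hFP' : Continuous fun kq : (ℝ × ℝ) × (ℝ × ℝ) =>
    fibrePair ε κ U v l (pairHat c.1) (bosonHat c.2) kq.1 kq.2 := hFP
  simp only [Function.uncurry_def]
  fun_prop

/-! ### From the form on finitely supported states to the bottom of the spectrum -/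

theorem isSelfAdjoint_sectorHamiltonian (ε hb κ : ℝ) (v : Coupling)
    (hsym : ∀ x : ℤ × ℤ, v (-x) = v x) (U : ℝ) :
    IsSelfAdjoint (sectorHamiltonian ε hb κ v U) := by
  rw [ContinuousLinearMap.isSelfAdjoint_iff_isSymmetric,
    LinearMap.isSymmetric_iff_inner_map_self_real]
  intro Ψ
  refine denseRange_sectorOfFinsupp.induction_on (p := fun Ψ : SectorSpace =>
    starRingEnd ℂ (inner ℂ (sectorHamiltonian ε hb κ v U Ψ) Ψ) =
      inner ℂ (sectorHamiltonian ε hb κ v U Ψ) Ψ) Ψ ?_ ?_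
  · exact isClosed_eq (by fun_prop) (by fun_prop)
  · intro c
    -- On the dense set the form is an average of real fibre forms, and reality passes to the
    -- closure.
    have h := inner_sectorHamiltonian_sub ε hb κ v hsym U 0 c
    rw [Complex.ofReal_zero, zero_smul, sub_zero] at h
    rw [← inner_conj_symm, h, Complex.conj_ofReal, Complex.conj_ofReal]

theorem isPositive_sectorHamiltonian_sub_iff (ε hb κ : ℝ) (v : Coupling)
    (hsym : ∀ x : ℤ × ℤ, v (-x) = v x) (U l : ℝ) :
    (sectorHamiltonian ε hb κ v U - (l : ℂ) • ContinuousLinearMap.id ℂ SectorSpace).IsPositive ↔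
      ∀ c : (Site × Site →₀ ℂ) × (Site →₀ ℂ),
        0 ≤ ∫ k, fibreForm ε hb κ U v l k (pairHat c.1 k) (bosonHat c.2 k) ∂torusMeasure := by
  have hinner : ∀ c, inner ℂ ((sectorHamiltonian ε hb κ v U -
      (l : ℂ) • ContinuousLinearMap.id ℂ SectorSpace) (sectorOfFinsupp c)) (sectorOfFinsupp c) =
      ((∫ k, fibreForm ε hb κ U v l k (pairHat c.1 k) (bosonHat c.2 k) ∂torusMeasure : ℝ) : ℂ) := by
    intro c
    have h := congrArg (starRingEnd ℂ) (inner_sectorHamiltonian_sub ε hb κ v hsym U l c)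
    rw [inner_conj_symm, Complex.conj_ofReal] at h
    exact h
  rw [ContinuousLinearMap.isPositive_iff_complex]
  constructor
  · intro h c
    have := (h (sectorOfFinsupp c)).2
    rw [hinner] at this
    exact_mod_cast this
  · intro h Ψ
    set T := sectorHamiltonian ε hb κ v U - (l : ℂ) • ContinuousLinearMap.id ℂ SectorSpace
    refine denseRange_sectorOfFinsupp.induction_on (p := fun Ψ : SectorSpace =>
      ((RCLike.re (inner ℂ (T Ψ) Ψ) : ℝ) : ℂ) = inner ℂ (T Ψ) Ψ ∧
        0 ≤ RCLike.re (inner ℂ (T Ψ) Ψ)) Ψ ?_ ?_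
    · have h1 : Continuous fun Ψ : SectorSpace => inner ℂ (T Ψ) Ψ := by fun_prop
      have h2 : Continuous fun Ψ : SectorSpace => RCLike.re (inner ℂ (T Ψ) Ψ) :=
        RCLike.continuous_re.comp h1
      exact (isClosed_eq (Complex.continuous_ofReal.comp h2) h1).inter
        (isClosed_le continuous_const h2)
    · intro c
      rw [hinner]
      exact ⟨by simp, by simpa using h c⟩

/-- For self-adjoint `T`, `l ≤ T` in the operator order means that `l` bounds the spectrum from
below. The spectrum is real, compact and nonempty, so its infimum is a genuine one. -/
theorem sInf_spectrum_lt_iff {H : Type*} [NormedAddCommGroup H] [InnerProductSpace ℂ H]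
    [CompleteSpace H] [Nontrivial H] {T : H →L[ℂ] H} (hT : IsSelfAdjoint T) (l : ℝ) :
    sInf {t : ℝ | (t : ℂ) ∈ spectrum ℂ T} < l ↔
      ¬ (T - (l : ℂ) • ContinuousLinearMap.id ℂ H).IsPositive := by
  have hS : {t : ℝ | (t : ℂ) ∈ spectrum ℂ T} = spectrum ℝ T := spectrum.preimage_algebraMap ℂ
  have hne : (spectrum ℝ T).Nonempty := by
    obtain ⟨z, hz⟩ := spectrum.nonempty T
    rw [hT.mem_spectrum_eq_re hz] at hz
    rw [← hS]
    exact ⟨z.re, hz⟩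
  have hle : (T - (l : ℂ) • ContinuousLinearMap.id ℂ H).IsPositive ↔
      algebraMap ℝ (H →L[ℂ] H) l ≤ T := Iff.rfl
  rw [hS, csInf_lt_iff (spectrum.isCompact T).bddBelow hne, hle, algebraMap_le_iff_le_spectrum hT]
  push Not
  rfl

instance : Nontrivial SectorSpace := by
  refine ⟨⟨sectorOfFinsupp (0, Finsupp.single 0 1), 0, fun h => ?_⟩⟩
  have h1 := congrArg (fun Ψ : SectorSpace => Ψ.snd (0 : Site)) h
  have h2 : ofFinsupp (Finsupp.single (0 : Site) (1 : ℂ)) 0 = 0 := h1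
  rw [ofFinsupp_apply] at h2
  simp at h2

theorem groundEnergy_lt_iff (ε hb κ : ℝ) (v : Coupling)
    (hsym : ∀ x : ℤ × ℤ, v (-x) = v x) (U l : ℝ) :
    groundEnergy ε hb κ v U < l ↔
      ∃ c : (Site × Site →₀ ℂ) × (Site →₀ ℂ),
        ∫ k, fibreForm ε hb κ U v l k (pairHat c.1 k) (bosonHat c.2 k) ∂torusMeasure < 0 := by
  rw [groundEnergy, sInf_spectrum_lt_iff (isSelfAdjoint_sectorHamiltonian ε hb κ v hsym U),
    isPositive_sectorHamiltonian_sub_iff ε hb κ v hsym U l]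
  push Not
  rfl

/-! ### Trigonometric polynomials -/

/-- The plane waves as characters of the lattice. -/
def waveHom : Multiplicative Site →* (ℝ × ℝ → ℂ) where
  toFun x := wave x.toAdd
  map_one' := funext wave_zero
  map_mul' x y := funext (wave_add x.toAdd y.toAdd)

/-- The algebra of trigonometric polynomials. -/
def trigAlgebra : Subalgebra ℂ (ℝ × ℝ → ℂ) := Algebra.adjoin ℂ (Set.range wave)

theorem wave_mem_trigAlgebra (x : Site) : wave x ∈ trigAlgebra :=
  Algebra.subset_adjoin ⟨x, rfl⟩

theorem const_mem_trigAlgebra (a : ℂ) : (fun _ => a) ∈ trigAlgebra :=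
  trigAlgebra.algebraMap_mem a

/-- Products of plane waves are plane waves, so the algebra they generate is merely their linear
span. -/
theorem exists_bosonHat {F : ℝ × ℝ → ℂ} (hF : F ∈ trigAlgebra) : ∃ b, bosonHat b = F := by
  have h : F ∈ Submodule.span ℂ (Set.range wave) := by
    have e : (Set.range wave : Set (ℝ × ℝ → ℂ)) = (MonoidHom.mrange waveHom : Set _) := by
      ext; rfl
    have h : F ∈ Subalgebra.toSubmodule trigAlgebra := hF
    rwa [trigAlgebra, Algebra.adjoin_eq_span, e, Submonoid.closure_eq, ← e] at h
  obtain ⟨b, hb⟩ := Finsupp.mem_span_range_iff_exists_finsupp.1 h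
  refine ⟨b, ?_⟩
  rw [← hb]
  funext k
  simp [bosonHat, Finsupp.sum]

theorem cos₂_sub_mem_trigAlgebra (k : ℝ × ℝ) :
    (fun q => (cos₂ (q - k) : ℂ)) ∈ trigAlgebra := by
  have h : (fun q => (cos₂ (q - k) : ℂ)) =
      ∑ z ∈ unitVectors, (fun _ => wave z (-k) / 2) * wave z := by
    funext q
    rw [Finset.sum_apply]
    have := sum_wave (q - k)
    simp only [sub_eq_add_neg q k, wave_add_right] at this
    simp only [Pi.mul_apply, sub_eq_add_neg q k]
    rw [← mul_right_inj' (two_ne_zero' ℂ), ← this, Finset.mul_sum]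
    exact Finset.sum_congr rfl fun z _ => by ring
  rw [h]
  exact sum_mem fun z _ => mul_mem (const_mem_trigAlgebra _) (wave_mem_trigAlgebra z)

theorem formFactor_mem_trigAlgebra (κ : ℝ) (k : ℝ × ℝ) :
    (fun q => (formFactor κ k q : ℂ)) ∈ trigAlgebra := by
  have h : (fun q => (formFactor κ k q : ℂ)) = (fun _ => (1 : ℂ)) +
      (fun _ => (2 * Real.exp (-κ) : ℂ)) * fun q => (cos₂ (q - k) : ℂ) := by
    funext q
    simp [formFactor]
  rw [h]
  exact add_mem (const_mem_trigAlgebra _)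
    (mul_mem (const_mem_trigAlgebra _) (cos₂_sub_mem_trigAlgebra k))

theorem dispersion_mem_trigAlgebra (ε : ℝ) (k : ℝ × ℝ) (l : ℝ) :
    (fun q => (dispersion ε k l q : ℂ)) ∈ trigAlgebra := by
  have h : (fun q => (dispersion ε k l q : ℂ)) = (fun _ => (4 * ε - l : ℂ)) -
      (fun _ => (ε : ℂ)) * ((fun q => (cos₂ (q - k) : ℂ)) + fun q => (cos₂ (q - 0) : ℂ)) := by
    funext q
    simp only [dispersion, Pi.sub_apply, Pi.mul_apply, Pi.add_apply, sub_zero]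
    push_cast
    ring
  rw [h]
  exact sub_mem (const_mem_trigAlgebra _) (mul_mem (const_mem_trigAlgebra _)
    (add_mem (cos₂_sub_mem_trigAlgebra k) (cos₂_sub_mem_trigAlgebra 0)))

theorem eval_mem_trigAlgebra (p : Polynomial ℝ) {f : ℝ × ℝ → ℝ}
    (hf : (fun q => (f q : ℂ)) ∈ trigAlgebra) :
    (fun q => ((p.eval (f q) : ℝ) : ℂ)) ∈ trigAlgebra := by
  have h : (fun q => ((p.eval (f q) : ℝ) : ℂ)) = ∑ i ∈ Finset.range (p.natDegree + 1),
      (fun _ => (p.coeff i : ℂ)) * (fun q => (f q : ℂ)) ^ i := by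
    funext q
    rw [Polynomial.eval_eq_sum_range, Finset.sum_apply]
    simp
  rw [h]
  exact sum_mem fun i _ => mul_mem (const_mem_trigAlgebra _) (pow_mem hf i)

theorem exists_pairHat_eq_mul (a b : Site →₀ ℂ) :
    ∃ c, ∀ k q, pairHat c k q = bosonHat a k * bosonHat b q := by
  let w : Site × Site → ℝ × ℝ → ℝ × ℝ → ℂ := fun p k q => wave p.1 (k - q) * wave p.2 q
  have h : (fun k q => bosonHat a k * bosonHat b q) ∈ Submodule.span ℂ (Set.range w) := by
    -- The frequencies `x` in `k` and `z` in `q` come from the pair of sites `(x, x + z)`, by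
    -- `wave_mul_wave_sub`.
    have e : (fun k q => bosonHat a k * bosonHat b q) =
        ∑ x ∈ a.support, ∑ z ∈ b.support, (a x * b z) • w (x, x + z) := by
      funext k q
      simp only [bosonHat, Finset.sum_mul_sum, Finset.sum_apply, Pi.smul_apply, smul_eq_mul, w,
        wave_mul_wave_sub, add_sub_cancel_left]
      exact Finset.sum_congr rfl fun x _ => Finset.sum_congr rfl fun z _ => by ring
    rw [e]
    exact sum_mem fun x _ => sum_mem fun z _ =>
      Submodule.smul_mem _ _ (Submodule.subset_span ⟨_, rfl⟩)
  obtain ⟨c, hc⟩ := Finsupp.mem_span_range_iff_exists_finsupp.1 h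
  refine ⟨c, fun k q => ?_⟩
  rw [← congrFun (congrFun hc k) q]
  simp [pairHat, Finsupp.sum, w]

/-! ### Negative fibres and the ground state energy -/

/-- After the square is completed with `t = v̂(k) β`, only the second term can be negative, and its
sign is that of the criterion at `(k, l)`. -/
theorem fibreForm_eq_square {ε : ℝ} (hε : 0 ≤ ε) (hb κ : ℝ) {U : ℝ} (hU : 0 ≤ U) (v : Coupling)
    {l : ℝ} (hl : l < 0) (k : ℝ × ℝ) {φ : ℝ × ℝ → ℂ} (hφ : Continuous φ) (β : ℂ) :
    fibreForm ε hb κ U v l k φ β =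
      pairForm (dispersion ε k l) U (fun q => φ q + (fourierRe v k * β) *
        minimizer (dispersion ε k l) (formFactor κ k) U q) +
      ‖β‖ ^ 2 * (bosonDispersion ε hb k - l -
        fourierRe v k ^ 2 * pairSusceptibility ε κ U k l) := by
  rw [fibreForm, fibreForm_eq hε κ hU k hl hφ, norm_mul, mul_pow, Complex.norm_real,
    Real.norm_eq_abs, sq_abs]
  ring

/-- For a product trial state the factor `a(k)` leaves each fibre as the weight `|a(k)|²`, which can
then be concentrated near one momentum. -/
theorem fibreForm_mul (ε hb κ U : ℝ) (v : Coupling) (l : ℝ) (k : ℝ × ℝ) (a : ℂ)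
    (φ : ℝ × ℝ → ℂ) :
    fibreForm ε hb κ U v l k (fun q => a * φ q) a = ‖a‖ ^ 2 * fibreForm ε hb κ U v l k φ 1 := by
  have h1 : ∀ q, dispersion ε k l q * ‖a * φ q‖ ^ 2 =
      ‖a‖ ^ 2 * (dispersion ε k l q * ‖φ q‖ ^ 2) := by
    intro q; rw [norm_mul]; ring
  have h2 : starRingEnd ℂ (fourierRe v k * a) *
      (a * ∫ q, (formFactor κ k q : ℂ) * φ q ∂torusMeasure) =
      ((‖a‖ ^ 2 : ℝ) : ℂ) * (starRingEnd ℂ (fourierRe v k * 1) *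
        ∫ q, (formFactor κ k q : ℂ) * φ q ∂torusMeasure) := by
    have : starRingEnd ℂ a * a = ((‖a‖ ^ 2 : ℝ) : ℂ) := by
      rw [mul_comm, Complex.mul_conj, Complex.normSq_eq_norm_sq]
    rw [← this, map_mul, map_mul, map_one]
    ring
  simp only [fibreForm, pairForm, h1, mul_left_comm _ a, integral_const_mul]
  rw [← mul_left_comm _ a, h2, Complex.re_ofReal_mul, norm_mul, norm_one]
  ring

theorem continuous_fibreForm (ε hb κ U : ℝ) (v : Coupling) (l : ℝ) {φ : ℝ × ℝ → ℂ}
    (hφ : Continuous φ) : Continuous fun k => fibreForm ε hb κ U v l k φ 1 := by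
  have h1 : Continuous fun k => ∫ q, dispersion ε k l q * ‖φ q‖ ^ 2 ∂torusMeasure :=
    continuous_integral_torusMeasure (F := fun k q => dispersion ε k l q * ‖φ q‖ ^ 2)
      (by simp only [Function.uncurry_def, dispersion]; fun_prop)
  have h2 : Continuous fun k => ∫ q, (formFactor κ k q : ℂ) * φ q ∂torusMeasure :=
    continuous_integral_torusMeasure (F := fun k q => (formFactor κ k q : ℂ) * φ q)
      (by simp only [Function.uncurry_def, formFactor]; fun_prop)
  unfold fibreForm pairForm
  fun_prop

/-- The optimal `φ` contains `1/d` and need not be a trigonometric polynomial. But `d` takes values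
in `[-l, 8ε - l]`, away from zero, so Weierstrass replaces `1/d` by a polynomial in `d` with uniform
error. -/
theorem exists_bosonHat_fibreForm_neg {ε : ℝ} (hε : 0 ≤ ε) (hb : ℝ) {κ : ℝ} (hκ : 0 < κ) {U : ℝ}
    (hU : 0 ≤ U) (v : Coupling) {l : ℝ} (hl : l < 0) {k : ℝ × ℝ}
    (h : bosonDispersion ε hb k - l < fourierRe v k ^ 2 * pairSusceptibility ε κ U k l) :
    ∃ P, fibreForm ε hb κ U v l k (bosonHat P) 1 < 0 := by
  set α := (∫ q, formFactor κ k q / dispersion ε k l q ∂torusMeasure) /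
    (1 + U * ∫ q, 1 / dispersion ε k l q ∂torusMeasure) with hα
  set γ := fourierRe v k ^ 2 * pairSusceptibility ε κ U k l - (bosonDispersion ε hb k - l) with hγ
  have hγ0 : 0 < γ := by linarith
  set C := |fourierRe v k| * (5 + |U * α|) with hC
  have hC0 : 0 ≤ C := by positivity
  -- `γ` is the energy gained at the exact minimizer. `C` bounds `|v̂ (g - Uα)|`, so an error `δ` in
  -- `1/d` moves the trial function by at most `C δ`, and `pairForm_le` bounds the resulting cost by
  -- the quantity kept below `γ`.
  obtain ⟨δ, hδ0, hδ⟩ : ∃ δ : ℝ, 0 < δ ∧ (8 * ε - l + U) * (C * δ) ^ 2 < γ := by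
    have ht : Tendsto (fun δ : ℝ => (8 * ε - l + U) * (C * δ) ^ 2) (𝓝[>] 0) (𝓝 0) := by
      have : Continuous fun δ : ℝ => (8 * ε - l + U) * (C * δ) ^ 2 := by fun_prop
      simpa using (this.tendsto 0).mono_left nhdsWithin_le_nhds
    obtain ⟨δ, h1, h2⟩ := ((ht.eventually (gt_mem_nhds hγ0)).and self_mem_nhdsWithin).exists
    exact ⟨δ, h2, h1⟩
  obtain ⟨p, hp⟩ := exists_polynomial_near_of_continuousOn (-l) (8 * ε - l) (fun x => 1 / x)
    (continuousOn_const.div continuousOn_id fun x hx => by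
      have := hx.1; exact (by linarith : (0 : ℝ) < x).ne') δ hδ0
  obtain ⟨P, hP⟩ := exists_bosonHat (mul_mem (mul_mem (const_mem_trigAlgebra (-fourierRe v k))
    (sub_mem (formFactor_mem_trigAlgebra κ k) (const_mem_trigAlgebra (U * α : ℝ))))
    (eval_mem_trigAlgebra p (dispersion_mem_trigAlgebra ε k l)))
  refine ⟨P, ?_⟩
  rw [fibreForm_eq_square hε hb κ hU v hl k (continuous_bosonHat P), norm_one]
  have hm := continuous_minimizer (continuous_dispersion ε k l) (continuous_formFactor κ k)
    (dispersion_pos hε k hl) U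
  have hle := pairForm_le (continuous_dispersion ε k l) (fun q => (dispersion_pos hε k hl q).le)
    (dispersion_le hε k l) hU (φ := fun q => bosonHat P q + (fourierRe v k * 1) *
        minimizer (dispersion ε k l) (formFactor κ k) U q) (δ := C * δ)
    (by fun_prop) fun q => ?_
  · linarith
  · have e : bosonHat P q + (fourierRe v k * 1) *
        minimizer (dispersion ε k l) (formFactor κ k) U q =
        ((-fourierRe v k * (formFactor κ k q - U * α) *
          ((p.eval (dispersion ε k l q) : ℝ) - 1 / dispersion ε k l q) : ℝ) : ℂ) := by
      rw [hP, minimizer, ← hα]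
      simp only [Pi.mul_apply, Pi.sub_apply]
      push_cast
      ring
    rw [e, Complex.norm_real, Real.norm_eq_abs, abs_mul, abs_mul, abs_neg, hC]
    have h1 := (hp _ ⟨neg_le_dispersion hε k l q, dispersion_le hε k l q⟩).le
    have h2 : |formFactor κ k q - U * α| ≤ 5 + |U * α| :=
      (abs_sub _ _).trans (by gcongr; exact abs_formFactor_le hκ k q)
    gcongr

/-- For interior `k` the coordinates of `k' - k` lie strictly between `±2π`. On the boundary of the
box the opposite point would be a second maximum. -/
theorem cos₂_sub_lt {k k' : ℝ × ℝ} (hk : k ∈ interior closedTorus) (hk' : k' ∈ closedTorus)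
    (hne : k' ≠ k) : cos₂ (k' - k) < 2 := by
  rw [closedTorus, interior_prod_eq, interior_Icc] at hk
  obtain ⟨⟨h1, h2⟩, ⟨h3, h4⟩⟩ := hk
  obtain ⟨⟨h5, h6⟩, ⟨h7, h8⟩⟩ := hk'
  refine lt_of_le_of_ne (cos₂_le _) fun h => hne ?_
  have e1 := Real.cos_le_one (k' - k).1
  have e2 := Real.cos_le_one (k' - k).2
  unfold cos₂ at h
  have c1 : Real.cos (k' - k).1 = 1 := by linarith
  have c2 : Real.cos (k' - k).2 = 1 := by linarith
  rw [Prod.fst_sub, Real.cos_eq_one_iff_of_lt_of_lt (by linarith) (by linarith)] at c1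
  rw [Prod.snd_sub, Real.cos_eq_one_iff_of_lt_of_lt (by linarith) (by linarith)] at c2
  exact Prod.ext (by linarith) (by linarith)

theorem torus_subset_closure_interior : torus ⊆ closure (interior closedTorus) := by
  have := Real.pi_pos
  rw [closedTorus, interior_prod_eq, interior_Icc, closure_prod_eq,
    closure_Ioo (by linarith : (-Real.pi) ≠ Real.pi)]
  exact Set.prod_mono Set.Ico_subset_Icc_self Set.Ico_subset_Icc_self

/-- A continuous function that is negative somewhere on the torus has a negative average
against the square of some trigonometric polynomial. -/
theorem exists_bosonHat_integral_neg {h : ℝ × ℝ → ℝ} (hc : Continuous h) {k : ℝ × ℝ}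
    (hk : k ∈ torus) (hneg : h k < 0) :
    ∃ a, ∫ k, ‖bosonHat a k‖ ^ 2 * h k ∂torusMeasure < 0 := by
  -- Negativity is an open condition, so the point can be moved into the interior, where the peak is
  -- unique.
  obtain ⟨k₀, hk₀neg, hk₀⟩ := mem_closure_iff.1 (torus_subset_closure_interior hk) {k | h k < 0}
    (isOpen_lt hc continuous_const) hneg
  have hpeak := tendsto_setIntegral_pow_smul_of_unique_maximum_of_isCompact_of_continuousOn
    (μ := (volume : Measure (ℝ × ℝ))) (c := fun k => (2 + cos₂ (k - k₀)) ^ 2) (x₀ := k₀) (g := h)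
    isCompact_closedTorus (by fun_prop) (fun k' hk' hne => by
      have h1 := cos₂_sub_lt hk₀ hk' hne
      have h2 := neg_two_le_cos₂ (k' - k₀)
      have h3 : cos₂ (k₀ - k₀) = 2 := by simp [cos₂]; norm_num
      rw [h3]
      nlinarith) (fun k _ => by positivity) (by
      have h3 : cos₂ (k₀ - k₀) = 2 := by simp [cos₂]; norm_num
      rw [h3]
      norm_num) (subset_closure hk₀) hc.continuousOn
  obtain ⟨n, hn⟩ := (hpeak.eventually (gt_mem_nhds hk₀neg)).exists
  -- The kernel carries the exponent `2n`, hence is the squared modulus of the trigonometric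
  -- polynomial `(2 + cos₂ (k - k₀))^n`.
  obtain ⟨a, ha⟩ := exists_bosonHat (pow_mem (add_mem (const_mem_trigAlgebra 2)
    (cos₂_sub_mem_trigAlgebra k₀)) n)
  refine ⟨a, ?_⟩
  have e : ∀ k, ‖bosonHat a k‖ ^ 2 = ((2 + cos₂ (k - k₀)) ^ 2) ^ n := by
    intro k
    have : bosonHat a k = (((2 + cos₂ (k - k₀)) ^ n : ℝ) : ℂ) := by
      rw [ha]
      simp
    rw [this, Complex.norm_real, Real.norm_eq_abs, sq_abs, pow_right_comm]
  have hnn : 0 ≤ (∫ k in closedTorus, ((2 + cos₂ (k - k₀)) ^ 2) ^ n)⁻¹ :=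
    inv_nonneg.2 (integral_nonneg fun k => by positivity)
  simp only [smul_eq_mul] at hn
  rw [integral_torusMeasure, smul_eq_mul]
  simp only [e]
  exact mul_neg_of_pos_of_neg (by positivity) (neg_of_mul_neg_right hn hnn)

theorem ae_mem_torus : ∀ᵐ k ∂torusMeasure, k ∈ torus := by
  rw [torusMeasure, ← Measure.restrict_congr_set torus_ae_eq_closedTorus]
  exact Measure.ae_smul_measure (ae_restrict_mem (measurableSet_Ico.prod measurableSet_Ico)) _

/-- If the bracket in `fibreForm_eq_square` is nonnegative for all `k`, every averaged form is
nonnegative. Otherwise a near-minimizer `P` at one `k`, held fixed while `k` varies, has negative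
form near that `k` by continuity, and a peaked factor `a(k)` localizes the average there. -/
theorem groundEnergy_lt_iff_exists {ε : ℝ} (hε : 0 ≤ ε) (hb : ℝ) {κ : ℝ} (hκ : 0 < κ)
    (v : Coupling) (hsym : ∀ x : ℤ × ℤ, v (-x) = v x) {U : ℝ} (hU : 0 ≤ U) {l : ℝ} (hl : l < 0) :
    groundEnergy ε hb κ v U < l ↔ ∃ k ∈ torus,
      bosonDispersion ε hb k - l < ‖fourier v k‖ ^ 2 * pairSusceptibility ε κ U k l := by
  simp only [norm_fourier_sq v hsym]
  rw [groundEnergy_lt_iff ε hb κ v hsym]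
  constructor
  · rintro ⟨c, hneg⟩
    by_contra! hall
    refine absurd (integral_nonneg_of_ae ?_) (not_le.2 hneg)
    filter_upwards [ae_mem_torus] with k hk
    have h1 := pairForm_nonneg (fun q => (dispersion_pos hε k hl q).le) hU
      (fun q => pairHat c.1 k q + (fourierRe v k * bosonHat c.2 k) *
        minimizer (dispersion ε k l) (formFactor κ k) U q)
    have h2 := mul_nonneg (sq_nonneg ‖bosonHat c.2 k‖) (sub_nonneg.2 (hall k hk))
    rw [fibreForm_eq_square hε hb κ hU v hl k (continuous_slice (continuous_pairHat c.1) k)]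
    exact add_nonneg h1 h2
  · rintro ⟨k, hk, h⟩
    obtain ⟨P, hP⟩ := exists_bosonHat_fibreForm_neg hε hb hκ hU v hl h
    obtain ⟨a, ha⟩ := exists_bosonHat_integral_neg
      (continuous_fibreForm ε hb κ U v l (continuous_bosonHat P)) hk hP
    obtain ⟨c, hc⟩ := exists_pairHat_eq_mul a P
    refine ⟨(c, a), ?_⟩
    have e : ∀ k, pairHat c k = fun q => bosonHat a k * bosonHat P q := fun k => funext (hc k)
    simp only [e, fibreForm_mul]
    exact ha

/-! ### The critical values -/

/-- With `r` strictly between `m` and the limsup, `f > r` at points arbitrarily close to `0`, where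
`-l` is smaller than the gap `r - m`. -/
theorem exists_of_limsup_sub_pos {f : ℝ → ℝ} {m : ℝ}
    (h : 0 < limsup (fun l => (f l : EReal)) (𝓝[<] 0) - (m : EReal)) :
    ∃ l < 0, m - l < f l := by
  have h1 : (m : EReal) < limsup (fun l => (f l : EReal)) (𝓝[<] 0) :=
    EReal.sub_pos.1 h
  obtain ⟨r, hmr, hr⟩ := EReal.lt_iff_exists_real_btwn.1 h1
  have hmr' : m < r := EReal.coe_lt_coe_iff.1 hmr
  have hfr := frequently_lt_of_lt_limsup (by isBoundedDefault) hr
  have hev : ∀ᶠ l in 𝓝[<] (0 : ℝ), m - r < l :=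
    nhdsWithin_le_nhds (lt_mem_nhds (by linarith))
  obtain ⟨l, ⟨hl1, hl2⟩, hl0⟩ := ((hfr.and_eventually hev).and_eventually
    (self_mem_nhdsWithin : ∀ᶠ l in 𝓝[<] (0 : ℝ), l ∈ Set.Iio 0)).exists
  have hl1' : r < f l := EReal.coe_lt_coe_iff.1 hl1
  exact ⟨l, hl0, by linarith⟩

/-- By monotonicity the value `f l` persists as a lower bound up to `0`, so one point determines the
sign. Only `m < f l` is needed, without the extra `-l`. -/
theorem limsup_sub_pos {f : ℝ → ℝ} (hf : ∀ l l' : ℝ, l' < 0 → l ≤ l' → f l ≤ f l') {m l : ℝ}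
    (hl : l < 0) (h : m < f l) :
    0 < limsup (fun l => (f l : EReal)) (𝓝[<] 0) - (m : EReal) := by
  refine EReal.sub_pos.2 (lt_of_lt_of_le (EReal.coe_lt_coe_iff.2 h) ?_)
  refine le_limsup_of_frequently_le (Eventually.frequently ?_) (by isBoundedDefault)
  filter_upwards [self_mem_nhdsWithin, nhdsWithin_le_nhds (lt_mem_nhds hl)] with l' h1 h2
  exact EReal.coe_le_coe_iff.2 (hf l l' h1 (le_of_lt h2))

theorem criticalValue_sub_pos_iff {ε : ℝ} (hε : 0 ≤ ε) (hb κ : ℝ) {U : ℝ} (hU : 0 ≤ U)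
    (v : Coupling) (k : ℝ × ℝ) :
    0 < criticalValue ε κ v U k - ((ε * hb * (2 - cos₂ k) : ℝ) : EReal) ↔
      ∃ l < 0, bosonDispersion ε hb k - l < ‖fourier v k‖ ^ 2 * pairSusceptibility ε κ U k l := by
  refine ⟨exists_of_limsup_sub_pos, fun ⟨l, hl, h⟩ => limsup_sub_pos
    (f := fun l => ‖fourier v k‖ ^ 2 * pairSusceptibility ε κ U k l)
    (fun l l' hl' hll' => ?_) hl ?_⟩
  · exact mul_le_mul_of_nonneg_left (pairSusceptibility_mono hε κ hU k hl' hll') (by positivity)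
  · have : bosonDispersion ε hb k < bosonDispersion ε hb k - l := by linarith
    exact this.trans h

theorem criticalValueInfinite_sub_pos {ε : ℝ} (hε : 0 ≤ ε) (hb : ℝ) {κ : ℝ} (hκ : 0 < κ)
    (v : Coupling) {k : ℝ × ℝ} {l : ℝ} (hl : l < 0)
    (h : bosonDispersion ε hb k < ‖fourier v k‖ ^ 2 * pairSusceptibilityInfinite ε κ k l) :
    0 < criticalValueInfinite ε κ v k - ((ε * hb * (2 - cos₂ k) : ℝ) : EReal) :=
  limsup_sub_pos (f := fun l => ‖fourier v k‖ ^ 2 * pairSusceptibilityInfinite ε κ k l)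
    (fun _ _ hl' hll' => mul_le_mul_of_nonneg_left
      (pairSusceptibilityInfinite_mono hε hκ k hl' hll') (by positivity)) hl h

theorem exists_of_criticalValueInfinite_sub_pos {ε hb κ : ℝ} {v : Coupling} {k : ℝ × ℝ}
    (h : 0 < criticalValueInfinite ε κ v k - ((ε * hb * (2 - cos₂ k) : ℝ) : EReal)) :
    ∃ l < 0, bosonDispersion ε hb k - l <
      ‖fourier v k‖ ^ 2 * pairSusceptibilityInfinite ε κ k l :=
  exists_of_limsup_sub_pos h

/-! ### The three assertions -/

theorem groundEnergy_neg_iff {ε : ℝ} (hε : 0 ≤ ε) (hb : ℝ) {κ : ℝ} (hκ : 0 < κ) (v : Coupling)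
    (hsym : ∀ x : ℤ × ℤ, v (-x) = v x) {U : ℝ} (hU : 0 ≤ U) :
    groundEnergy ε hb κ v U < 0 ↔ 0 < ⨆ k ∈ torus,
      (criticalValue ε κ v U k - ((ε * hb * (2 - cos₂ k) : ℝ) : EReal)) := by
  simp only [lt_iSup_iff, criticalValue_sub_pos_iff hε hb κ hU]
  constructor
  · intro h
    obtain ⟨l, h1, h2⟩ := exists_between h
    obtain ⟨k, hk, hkl⟩ := (groundEnergy_lt_iff_exists hε hb hκ v hsym hU h2).1 h1
    exact ⟨k, hk, l, h2, hkl⟩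
  · rintro ⟨k, hk, l, hl, hkl⟩
    exact ((groundEnergy_lt_iff_exists hε hb hκ v hsym hU hl).2 ⟨k, hk, hkl⟩).trans hl

theorem zero_mem_torus : ((0, 0) : ℝ × ℝ) ∈ torus := by
  have := Real.pi_pos
  exact ⟨⟨by simpa using this.le, this⟩, ⟨by simpa using this.le, this⟩⟩

/-- At `k = 0` the boson has no kinetic energy, so positivity of the susceptibility at any one
energy, here `l = -1`, suffices. -/
theorem iSup_criticalValue_pos {ε : ℝ} (hε : 0 ≤ ε) (hb κ : ℝ) {U : ℝ} (hU : 0 ≤ U)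
    (v : Coupling) (hv : fourier v (0, 0) ≠ 0) :
    0 < ⨆ k ∈ torus, (criticalValue ε κ v U k - ((ε * hb * (2 - cos₂ k) : ℝ) : EReal)) := by
  simp only [lt_iSup_iff]
  refine ⟨(0, 0), zero_mem_torus, limsup_sub_pos
    (f := fun l => ‖fourier v (0, 0)‖ ^ 2 * pairSusceptibility ε κ U (0, 0) l)
    (fun l l' hl' hll' => mul_le_mul_of_nonneg_left
      (pairSusceptibility_mono hε κ hU _ hl' hll') (by positivity)) neg_one_lt_zero ?_⟩
  have h := pairSusceptibility_pos hε κ hU (0, 0) neg_one_lt_zero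
  have e : ε * hb * (2 - cos₂ (0, 0)) = 0 := by
    simp [cos₂, one_add_one_eq_two]
  rw [e]
  have := norm_pos_iff.2 hv
  positivity

theorem liminf_groundEnergy_neg_iff {ε : ℝ} (hε : 0 ≤ ε) (hb : ℝ) {κ : ℝ} (hκ : 0 < κ)
    (v : Coupling) (hsym : ∀ x : ℤ × ℤ, v (-x) = v x) :
    liminf (fun U : ℝ => ((groundEnergy ε hb κ v U : ℝ) : EReal)) atTop < 0 ↔
      0 < ⨆ k ∈ torus,
        (criticalValueInfinite ε κ v k - ((ε * hb * (2 - cos₂ k) : ℝ) : EReal)) := by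
  simp only [lt_iSup_iff]
  constructor
  · intro h
    obtain ⟨l, h1, h2⟩ := EReal.lt_iff_exists_real_btwn.1 h
    have hl : l < 0 := by exact_mod_cast h2
    set N := ∑' x, ‖v x‖ with hN
    have ht : Tendsto (fun U : ℝ => N ^ 2 * (25 / U)) atTop (𝓝 (N ^ 2 * 0)) :=
      (tendsto_const_nhds.div_atTop tendsto_id).const_mul _
    rw [mul_zero] at ht
    -- Take `U` so large that the error `N² · 25 / U` is below the slack `-l`. The momentum found
    -- afterwards depends on `U`, so the bound `N` on the transform has to be uniform in `k`.
    obtain ⟨U, ⟨hU1, hU2⟩, hU0⟩ := (((frequently_lt_of_liminf_lt (by isBoundedDefault) h1)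
      |>.and_eventually (ht.eventually (gt_mem_nhds (by linarith : 0 < -l))))
      |>.and_eventually (eventually_gt_atTop 0)).exists
    have hU1' : groundEnergy ε hb κ v U < l := EReal.coe_lt_coe_iff.1 hU1
    obtain ⟨k, hk, hkl⟩ := (groundEnergy_lt_iff_exists hε hb hκ v hsym hU0.le hl).1 hU1'
    refine ⟨k, hk, criticalValueInfinite_sub_pos hε hb hκ v hl ?_⟩
    have e1 := mul_le_mul_of_nonneg_left (pairSusceptibility_le hε hκ hU0 k hl)
      (sq_nonneg ‖fourier v k‖)
    have e2 : ‖fourier v k‖ ^ 2 * (25 / U) ≤ N ^ 2 * (25 / U) := by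
      have := norm_fourier_le v k
      gcongr
    linarith
  · rintro ⟨k, hk, h⟩
    obtain ⟨l, hl, hkl⟩ := exists_of_criticalValueInfinite_sub_pos h
    -- The same `l < 0` bounds the ground state energy for all `U ≥ 0`, since the infinite-`U`
    -- susceptibility is the smaller one; this keeps the liminf away from `0`.
    refine lt_of_le_of_lt (b := (l : EReal)) ?_ (by exact_mod_cast hl)
    refine liminf_le_of_frequently_le (Eventually.frequently ?_) (by isBoundedDefault)
    filter_upwards [eventually_ge_atTop 0] with U hU
    refine EReal.coe_le_coe_iff.2 ((groundEnergy_lt_iff_exists hε hb hκ v hsym hU hl).2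
      ⟨k, hk, hkl.trans_le ?_⟩).le
    exact mul_le_mul_of_nonneg_left (pairSusceptibilityInfinite_le hε κ hU k hl) (by positivity)

end BipolaronElectron

end

theorem theorem3p1 (ε hb κ : ℝ) (hε : 0 ≤ ε) (hhb : 0 ≤ hb) (hκ : 0 < κ)
    (v : BipolaronElectron.Coupling) (hsym : ∀ x : ℤ × ℤ, v (-x) = v x)
    (hrot : ∀ x₁ x₂ : ℤ, v (-x₂, x₁) = v (x₁, x₂)) :
    (∀ U : ℝ, 0 ≤ U →
      (BipolaronElectron.groundEnergy ε hb κ v U < 0 ↔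
        0 < ⨆ k ∈ BipolaronElectron.torus,
          (BipolaronElectron.criticalValue ε κ v U k -
            ((ε * hb * (2 - BipolaronElectron.cos₂ k) : ℝ) : EReal))) ∧
      (BipolaronElectron.fourier v (0, 0) ≠ 0 →
        0 < ⨆ k ∈ BipolaronElectron.torus,
          (BipolaronElectron.criticalValue ε κ v U k -
            ((ε * hb * (2 - BipolaronElectron.cos₂ k) : ℝ) : EReal)))) ∧
    (liminf (fun U : ℝ => ((BipolaronElectron.groundEnergy ε hb κ v U : ℝ) : EReal)) atTop < 0 ↔
      0 < ⨆ k ∈ BipolaronElectron.torus,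
        (BipolaronElectron.criticalValueInfinite ε κ v k -
          ((ε * hb * (2 - BipolaronElectron.cos₂ k) : ℝ) : EReal))) := by
  exact ⟨fun _ hU => ⟨BipolaronElectron.groundEnergy_neg_iff hε hb hκ v hsym hU,
    BipolaronElectron.iSup_criticalValue_pos hε hb κ hU v⟩,
    BipolaronElectron.liminf_groundEnergy_neg_iff hε hb hκ v hsym⟩
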